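/- Let $R$ be a commutative artinian ring and let $\Lambda$ be an artin $R$-algebra, that is, an $R$-algebra which is finitely generated as an $R$-module. Write $\mathrm{mod}(\Lambda)$ for the category of finitely generated left $\Lambda$-modules. For a family $\mathcal C$ of modules let $\mathcal F(\mathcal C)$ be the class of all modules $M$ that have a finite filtration $0=M_0\subseteq M_1\subseteq\cdots\subseteq M_s=M$ by submodules such that each $M_{k+1}/M_k$ is isomorphic to a member of $\mathcal C$. For a class $\mathcal X$ in $\mathrm{mod}(\Lambda)$ let ${}^{\perp_1}\mathcal X=\{M\in\mathrm{mod}(\Lambda):\mathrm{Ext}^1_\Lambda(M,X)=0\text{ for all }X\in\mathcal X\}$, and let $\mathrm{add}(M)$ be the class of direct summands of finite direct sums of copies of $M$. An Ext-projective stratifying system $(\Theta,\underline Q,\le)$ of size $t$ in $\mathrm{mod}(\Lambda)$ consists of two families $\Theta=\{\Theta(i)\}_{i=1}^t$ and $\underline Q=\{Q(i)\}_{i=1}^t$ of non-zero finitely generated $\Lambda$-modules, with every $Q(i)$ indecomposable, and a linear order $\le$ on $[1,t]=\{1,\dots,t\}$, such that - $\mathrm{Hom}_\Lambda(\Theta(i),\Theta(j))=0$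 whenever $i>j$; - for each $i$ there is an exact sequence $0\to K(i)\to Q(i)\to\Theta(i)\to0$ with $K(i)\in\mathcal F(\{\Theta(j):j>i\})$; - $\mathrm{Ext}^1_\Lambda(Q(i),\Theta(j))=0$ for all $i,j\in[1,t]$. Let $(\Theta,\underline Q,\le)$ be such a system, and put $Q=\bigoplus_{i=1}^tQ(i)$ and $\Gamma=\mathrm{End}_\Lambda(Q)^{op}$. Then $\Gamma$ is an artin $R$-algebra, and $F=\mathrm{Hom}_\Lambda(Q,-)$ and $G=Q\otimes_\Gamma-$ are functors $F:\mathrm{mod}(\Lambda)\to\mathrm{mod}(\Gamma)$ and $G:\mathrm{mod}(\Gamma)\to\mathrm{mod}(\Lambda)$. For $i\in[1,t]$ put ${}_\Gamma P(i)=F(Q(i))$ and $${}_\Gamma\Delta(i)={}_\Gamma P(i)\big/\mathrm{Tr}_{\bigoplus_{j>i}{}_\Gamma P(j)}\big({}_\Gamma P(i)\big),$$ where $\mathrm{Tr}_M(N)$ is the submodule of $N$ generated by the images of all homomorphisms $M\to N$; let ${}_\Gamma\Delta=\{{}_\Gamma\Delta(i)\}_{i=1}^t$. The following hold. (a) The family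 $\{F(Q(i)):i\in[1,t]\}$ is a representative set of the indecomposable projective $\Gamma$-modules: it contains exactly one module of each isomorphism class of these, and $F(Q(i))\not\simeq F(Q(j))$ for $i\ne j$. Moreover, $\Gamma$ is basic, that is, ${}_\Gamma\Gamma$ is a direct sum of pairwise non-isomorphic indecomposable modules, and the Grothendieck group $K_0(\Gamma)$ of $\mathrm{mod}(\Gamma)$ has rank $t$. (b) $(\Gamma,\le)$ is a standardly stratified algebra, that is, every finitely generated projective $\Gamma$-module lies in $\mathcal F({}_\Gamma\Delta)$. (c) $F$ restricts to an equivalence of categories $\mathcal F(\Theta)\to\mathcal F({}_\Gamma\Delta)$, which is exact (it carries short exact sequences with all terms in $\mathcal F(\Theta)$ to short exact sequences), and $G$ restricts to a functor $\mathcal F({}_\Gamma\Delta)\to\mathcal F(\Theta)$ which is a quasi-inverse of it. (d) $F(\Theta(i))\simeq{}_\Gamma\Delta(i)$ for all $i\in[1,t]$. (e) $\mathrm{add}(Q)=\mathcal F(\Theta)\cap{}^{\perp_1}\mathcal F(\Theta)$. -/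

import Mathlib

universe w u

open CategoryTheory
open scoped TensorProduct

noncomputable section

namespace StratSys

section Modules

variable {A : Type u} [Ring A]

/-- `X` has a finite filtration `0 = N 0 ⊆ N 1 ⊆ ⋯ ⊆ N s = X` by submodules, every factor
`N (k + 1) / N k` of which is isomorphic to some `C i` with `p i`. This is the class
`𝓕({C i : p i})`. -/
def FilteredBy {ι : Type} (C : ι → ModuleCat.{u} A) (p : ι → Prop) :
    ObjectProperty (ModuleCat.{u} A) := fun X =>
  ∃ (s : ℕ) (N : ℕ → Submodule A X), N 0 = ⊥ ∧ N s = ⊤ ∧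
    ∀ k, k < s → N k ≤ N (k + 1) ∧
      ∃ i, p i ∧ Nonempty ((↥(N (k + 1)) ⧸ (N k).submoduleOf (N (k + 1))) ≃ₗ[A] C i)

/-- The class `𝓕(C)` of modules filtered by the family `C`. -/
abbrev Filtered {ι : Type} (C : ι → ModuleCat.{u} A) : ObjectProperty (ModuleCat.{u} A) :=
  FilteredBy C (fun _ => True)

/-- `Ext¹_A(X, Y) = 0`. -/
def ExtOneVanishes (X Y : ModuleCat.{u} A) : Prop :=
  Subsingleton (Abelian.Ext.{u} X Y 1)

/-- The class of finitely generated `X` with `Ext¹(X, Y) = 0` for all `Y` in `C`. -/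
def LeftPerpOne (C : ObjectProperty (ModuleCat.{u} A)) : ObjectProperty (ModuleCat.{u} A) :=
  fun X => Module.Finite A X ∧ ∀ Y, C Y → ExtOneVanishes X Y

/-- `add M`: the direct summands of finite direct sums of copies of `M`. -/
def AddClosure (M : ModuleCat.{u} A) : ObjectProperty (ModuleCat.{u} A) := fun X =>
  ∃ (n : ℕ) (Y : ModuleCat.{u} A), Nonempty ((X × Y) ≃ₗ[A] (Fin n → M))

/-- The direct sum of a finite family of modules. -/
def finSum {ι : Type} [Finite ι] (M : ι → ModuleCat.{u} A) : ModuleCat.{u} A :=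
  ModuleCat.of A (∀ i, M i)

/-- The trace of `M` in `N`: the submodule generated by the images of all maps `M → N`. -/
def trace (M N : ModuleCat.{u} A) : Submodule A N :=
  ⨆ f : M →ₗ[A] N, LinearMap.range f

/-- The standard module `Δ(i) = P(i) / Tr_{⨁_{j > i} P(j)} P(i)`. -/
def standardModule {ι : Type} [Finite ι] [LinearOrder ι] (P : ι → ModuleCat.{u} A) (i : ι) :
    ModuleCat.{u} A :=
  ModuleCat.of A (P i ⧸ trace (finSum fun j : {j : ι // i < j} => P j) (P i))

variable (A) in
/-- The algebra `A` is basic: the left regular module is a direct sum of pairwise non-isomorphic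
indecomposable modules. -/
def IsBasic : Prop :=
  ∃ (n : ℕ) (P : Fin n → ModuleCat.{u} A), Nonempty (A ≃ₗ[A] ∀ i, P i) ∧
    (∀ i, Indecomposable (P i)) ∧ ∀ i j, Nonempty (P i ≅ P j) → i = j

/-- `P` contains exactly one module of each isomorphism class of (finitely generated)
indecomposable projective `A`-modules. -/
structure IsRepresentativeSet {ι : Type} (P : ι → ModuleCat.{u} A) : Prop where
  finite : ∀ i, Module.Finite A (P i)
  projective : ∀ i, Module.Projective A (P i)
  indecomposable : ∀ i, Indecomposable (P i)
  injective : ∀ i j, Nonempty (P i ≅ P j) → i = j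
  exhaustive : ∀ X : ModuleCat.{u} A, Module.Finite A X → Module.Projective A X →
    Indecomposable X → ∃ i, Nonempty (X ≅ P i)

/-- `A` is standardly stratified with respect to the linear order on the index set `ι` of the
representative set `P` of indecomposable projectives: `proj A ⊆ 𝓕(Δ)`. -/
structure IsStandardlyStratified {ι : Type} [Finite ι] [LinearOrder ι]
    (P : ι → ModuleCat.{u} A) : Prop where
  representative : IsRepresentativeSet P
  filtered : ∀ X : ModuleCat.{u} A, Module.Finite A X → Module.Projective A X →
    Filtered (standardModule P) X

variable (A) in
/-- The finitely generated `A`-modules, the generators of the Grothendieck group. -/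
abbrev FGMod : Type (u + 1) := {X : ModuleCat.{u} A // Module.Finite A X}

variable (A) in
/-- The elements `[Y] - [X] - [Z]` for short exact sequences `0 → X → Y → Z → 0` of finitely
generated modules. -/
def K0Relations : Set (FreeAbelianGroup (FGMod A)) :=
  {x | ∃ (X Y Z : FGMod A) (f : X.1 →ₗ[A] Y.1) (g : Y.1 →ₗ[A] Z.1),
    Function.Injective f ∧ Function.Exact f g ∧ Function.Surjective g ∧
    x = FreeAbelianGroup.of Y - FreeAbelianGroup.of X - FreeAbelianGroup.of Z}

variable (A) in
/-- The Grothendieck group of the category of finitely generated `A`-modules. -/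
abbrev K0 : Type (u + 1) :=
  FreeAbelianGroup (FGMod A) ⧸ AddSubgroup.closure (K0Relations A)

/-- An Ext-projective stratifying system `(Θ, Q, ≤)` in the category of finitely generated
`A`-modules, indexed by a finite linearly ordered set `ι`. -/
structure IsExtProjectiveStratifyingSystem {ι : Type} [Finite ι] [LinearOrder ι]
    (Θ Q : ι → ModuleCat.{u} A) : Prop where
  finite_theta : ∀ i, Module.Finite A (Θ i)
  finite_Q : ∀ i, Module.Finite A (Q i)
  nontrivial_theta : ∀ i, Nontrivial (Θ i)
  indecomposable_Q : ∀ i, Indecomposable (Q i)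
  hom_eq_zero : ∀ i j, j < i → ∀ f : Θ i →ₗ[A] Θ j, f = 0
  exists_sequence : ∀ i, ∃ (K : ModuleCat.{u} A) (α : K →ₗ[A] Q i) (β : Q i →ₗ[A] Θ i),
    Function.Injective α ∧ Function.Exact α β ∧ Function.Surjective β ∧
    FilteredBy Θ (fun j => i < j) K
  ext_vanishes : ∀ i j, ExtOneVanishes (Q i) (Θ j)

end Modules

section Functors

variable {Λ : Type u} [Ring Λ] (M : ModuleCat.{u} Λ)

/-- The opposite `End_Λ(M)ᵒᵖ` of the endomorphism ring of `M`. -/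
abbrev EndOp : Type u := (Module.End Λ M)ᵐᵒᵖ

/-- The structure of `R`-algebra on `End_Λ(M)ᵒᵖ`, for an `R`-algebra `Λ`. -/
@[reducible] def endOpAlgebra (R : Type w) [CommRing R] [Algebra R Λ] : Algebra R (EndOp M) :=
  letI : Module R M := Module.restrictScalars R Λ M
  haveI : IsScalarTower R Λ M := IsScalarTower.restrictScalars R Λ M
  inferInstance

/-- `Hom_Λ(M, X)` is a left `End_Λ(M)ᵒᵖ`-module by precomposition. -/
instance homModule (X : ModuleCat.{u} Λ) : Module (EndOp M) (M →ₗ[Λ] X) where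
  smul γ h := h ∘ₗ γ.unop
  one_smul _ := rfl
  mul_smul _ _ _ := rfl
  smul_zero _ := rfl
  smul_add _ _ _ := rfl
  add_smul γ γ' h := LinearMap.comp_add γ.unop γ'.unop h
  zero_smul h := LinearMap.comp_zero h

/-- The functor `F = Hom_Λ(M, -)` from `Λ`-modules to `End_Λ(M)ᵒᵖ`-modules. -/
def homFunctor : ModuleCat.{u} Λ ⥤ ModuleCat.{u} (EndOp M) where
  obj X := ModuleCat.of (EndOp M) (M →ₗ[Λ] X)
  map {_ _} f := ModuleCat.ofHom
    { toFun := fun h => f.hom ∘ₗ h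
      map_add' := fun h h' => LinearMap.comp_add h h' f.hom
      map_smul' := fun _ _ => rfl }
  map_id _ := rfl
  map_comp _ _ := rfl

instance : (homFunctor M).Additive where
  map_add {_ _ _ _} := rfl

/-- The submodule of `M ⊗_ℤ Y` generated by the elements `mγ ⊗ y - m ⊗ γy`, where
`γ ∈ End_Λ(M)ᵒᵖ` acts on `M` from the right by `mγ = γ(m)`. -/
def balancedRel (Y : ModuleCat.{u} (EndOp M)) : Submodule Λ (M ⊗[ℤ] Y) :=
  Submodule.span Λ {z | ∃ (m : M) (γ : EndOp M) (y : Y), z = γ.unop m ⊗ₜ[ℤ] y - m ⊗ₜ[ℤ] (γ • y)}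

/-- The map `M ⊗_ℤ Y → M ⊗_ℤ Y'` induced by `f : Y → Y'`. -/
def tensorMap {Y Y' : ModuleCat.{u} (EndOp M)} (f : Y ⟶ Y') :
    M ⊗[ℤ] Y →ₗ[Λ] M ⊗[ℤ] Y' :=
  TensorProduct.AlgebraTensorModule.map LinearMap.id f.hom.toAddMonoidHom.toIntLinearMap

lemma tensorMap_tmul {Y Y' : ModuleCat.{u} (EndOp M)} (f : Y ⟶ Y') (m : M) (y : Y) :
    tensorMap M f (m ⊗ₜ y) = m ⊗ₜ (f.hom y) := rfl

lemma balancedRel_le {Y Y' : ModuleCat.{u} (EndOp M)} (f : Y ⟶ Y') :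
    balancedRel M Y ≤ (balancedRel M Y').comap (tensorMap M f) := by
  refine Submodule.span_le.2 ?_
  rintro _ ⟨m, γ, y, rfl⟩
  refine Submodule.subset_span ⟨m, γ, f.hom y, ?_⟩
  rw [map_sub, tensorMap_tmul, tensorMap_tmul, map_smul]

/-- The functor `G = M ⊗_Γ -` from modules over `Γ = End_Λ(M)ᵒᵖ` to `Λ`-modules. -/
def tensorFunctor : ModuleCat.{u} (EndOp M) ⥤ ModuleCat.{u} Λ where
  obj Y := ModuleCat.of Λ ((M ⊗[ℤ] Y) ⧸ balancedRel M Y)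
  map {Y Y'} f := ModuleCat.ofHom
    (Submodule.mapQ (balancedRel M Y) (balancedRel M Y') (tensorMap M f) (balancedRel_le M f))
  map_id Y := by
    have h : tensorMap M (𝟙 Y) = LinearMap.id := by
      refine TensorProduct.AlgebraTensorModule.ext fun m y => rfl
    refine ModuleCat.hom_ext (Submodule.linearMap_qext _ (LinearMap.ext fun x => ?_))
    simp [h]
  map_comp {Y Y' Y''} f g := by
    have h : tensorMap M (f ≫ g) = tensorMap M g ∘ₗ tensorMap M f := by
      refine TensorProduct.AlgebraTensorModule.ext fun m y => rfl
    refine ModuleCat.hom_ext (Submodule.linearMap_qext _ (LinearMap.ext fun x => ?_))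
    simp [h]

end Functors

end StratSys

end

open StratSys

/-! Everything rests on covers. Splicing the sequences `0 → K(i) → Q(i) → Θ(i) → 0` along a
filtration, as in the horseshoe lemma, gives every `X` in `𝓕(Θ)` a sequence `0 → Z → Y → X → 0` with
`Y` in `add Q` and `Z` in `𝓕(Θ)` (`exists_cover`). The lifts needed exist because `Ext¹(Q(i), -)`
vanishes on `𝓕(Θ)`; for the same reason `F` is exact there. If `Ext¹(X, -)` also vanishes on `𝓕(Θ)`,
the cover splits, which is (e). The counit `GF(X) → X` of the adjunction `G ⊣ F` is evaluation. It
is bijective for `X = Q`, and a diagram chase along covers extends this to `𝓕(Θ)`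
(`evalMap_bijective`), so `F` is fully faithful there. For (d), the image of `F(K(i))` in `P(i)` is
the trace: maps `Q(j) → Θ(i)` vanish for `j > i`, and `K(i)` is covered by sums of such `Q(j)`
(`trace_eq_range_homMap`). A pushout construction shows that every module in `𝓕(Δ)` is some `F(X)`
(`exists_equiv_homFunctor_obj`), and the triangle identities then give (c). Projective `Γ`-modules
lie in `add {F(Q(i))}`, where full faithfulness and local endomorphism rings give (a) and (b). The
rank of `K₀(Γ)` is at most `t` since the tops of the `P(i)` exhaust the simples, and at least `t`
since the lengths of `Hom(Q(i), Θ(j))` form a triangular matrix (`rank_K0`). Membership in `add` of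
a family is expressed by the identity being a sum of maps through members (`through`), so that
additive arguments need no explicit decompositions. -/

noncomputable section

namespace StratSys

/-! ### Filtrations: induction on the top factor, closure under extensions. -/

section Filtered

variable {A : Type u} [Ring A] {ι : Type} {C : ι → ModuleCat.{u} A} {p : ι → Prop}

lemma FilteredBy.of_subsingleton (X : ModuleCat.{u} A) [Subsingleton X] : FilteredBy C p X :=
  ⟨0, fun _ => ⊥, rfl, Subsingleton.elim _ _, fun _ h => absurd h (Nat.not_lt_zero _)⟩

/-- The filtration of `X'` is carried over by `f` and `⊤` is appended; the new top factor is `X /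
f(X') ≃ C i`. -/
lemma FilteredBy.extend {X' X : ModuleCat.{u} A} {i : ι} (hi : p i) {f : X' →ₗ[A] X}
    {g : X →ₗ[A] C i} (hf : Function.Injective f) (hfg : Function.Exact f g)
    (hg : Function.Surjective g) (h : FilteredBy C p X') : FilteredBy C p X := by
  obtain ⟨s, N, h0, hs, hN⟩ := h
  obtain ⟨M, hM, hM'⟩ : ∃ M : ℕ → Submodule A X, (∀ k, k ≤ s → M k = (N k).map f) ∧
      M (s + 1) = ⊤ :=
    ⟨fun k => if k ≤ s then (N k).map f else ⊤, fun k hk => if_pos hk, by simp⟩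
  refine ⟨s + 1, M, by simp [hM, h0], hM', ?_⟩
  intro k hk
  rcases Nat.lt_succ_iff_lt_or_eq.1 hk with hk | rfl
  · obtain ⟨hle, j, hj, ⟨e⟩⟩ := hN k hk
    rw [hM k hk.le, hM (k + 1) hk]
    refine ⟨Submodule.map_mono hle, j, hj, ⟨(Submodule.Quotient.equiv _ _
      (Submodule.equivMapOfInjective f hf (N (k + 1))) ?_).symm.trans e⟩⟩
    ext ⟨x, hx⟩
    obtain ⟨y, hy, rfl⟩ := hx
    simp only [Submodule.mem_map, Submodule.submoduleOf, Submodule.mem_comap,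
      Submodule.subtype_apply]
    constructor
    · rintro ⟨⟨z, hz⟩, hz', hzy⟩
      exact ⟨z, hz', congrArg Subtype.val hzy⟩
    · rintro ⟨z, hz, hzy⟩
      exact ⟨⟨z, hle hz⟩, hz, Subtype.ext hzy⟩
  · rw [hM k le_rfl, hM', hs]
    refine ⟨le_top, i, hi, ⟨LinearEquiv.trans (Submodule.quotEquivOfEq _ _ ?_)
      ((g ∘ₗ (⊤ : Submodule A X).subtype).quotKerEquivOfSurjective ?_)⟩⟩
    · ext ⟨x, hx⟩
      simp [Submodule.submoduleOf, hfg x]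
    · intro y
      obtain ⟨x, rfl⟩ := hg y
      exact ⟨⟨x, trivial⟩, rfl⟩

/-- Induction over the length of a filtration, peeling off the top factor. -/
lemma FilteredBy.induction {motive : ModuleCat.{u} A → Prop}
    (zero : ∀ X : ModuleCat.{u} A, Subsingleton X → motive X)
    (step : ∀ (X' X : ModuleCat.{u} A) (i : ι) (f : X' →ₗ[A] X) (g : X →ₗ[A] C i), p i →
      Function.Injective f → Function.Exact f g → Function.Surjective g →
      FilteredBy C p X' → motive X' → motive X)
    {X : ModuleCat.{u} A} (h : FilteredBy C p X) : motive X := by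
  obtain ⟨s, N, h0, hs, hN⟩ := h
  -- Quantifying over all `Y` isomorphic to `N k` lets the induction end at `X` itself instead of `N
  -- s`, without assuming that `motive` is invariant under isomorphism.
  have key : ∀ k, k ≤ s → ∀ Y : ModuleCat.{u} A, Nonempty (Y ≃ₗ[A] N k) →
      FilteredBy C p Y ∧ motive Y := by
    intro k
    induction k with
    | zero =>
      rintro - Y ⟨e⟩
      have : Subsingleton (N 0) := by rw [h0]; infer_instance
      have : Subsingleton Y := e.injective.subsingleton
      exact ⟨.of_subsingleton Y, zero Y this⟩
    | succ k ih =>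
      rintro hk Y ⟨e⟩
      obtain ⟨hle, i, hi, ⟨e'⟩⟩ := hN k hk
      obtain ⟨h1, h2⟩ := ih (Nat.le_of_succ_le hk) (ModuleCat.of A (N k)) ⟨LinearEquiv.refl _ _⟩
      let f : ModuleCat.of A (N k) →ₗ[A] Y := e.symm.toLinearMap ∘ₗ Submodule.inclusion hle
      let g : Y →ₗ[A] C i := e'.toLinearMap ∘ₗ Submodule.mkQ _ ∘ₗ e.toLinearMap
      have hf : Function.Injective f :=
        e.symm.injective.comp (Submodule.inclusion_injective hle)
      have hg : Function.Surjective g :=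
        e'.surjective.comp ((Submodule.mkQ_surjective _).comp e.surjective)
      have hfg : Function.Exact f g := by
        intro y
        have : g y = 0 ↔ ((e y : X) ∈ N k) := by
          change e' (Submodule.Quotient.mk (e y)) = 0 ↔ _
          rw [LinearEquiv.map_eq_zero_iff, Submodule.Quotient.mk_eq_zero]
          rfl
        rw [this]
        constructor
        · intro hy
          exact ⟨⟨_, hy⟩, e.injective (Subtype.ext (by simp [f]))⟩
        · rintro ⟨z, rfl⟩
          simp [f]
      exact ⟨h1.extend hi hf hfg hg, step _ _ i f g hi hf hfg hg h1 h2⟩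
  exact (key s le_rfl X ⟨(LinearEquiv.ofTop _ hs).symm⟩).2

lemma FilteredBy.of_equiv {X Y : ModuleCat.{u} A} (e : X ≃ₗ[A] Y) (h : FilteredBy C p X) :
    FilteredBy C p Y := by
  revert Y
  refine FilteredBy.induction (motive := fun X => ∀ {Y : ModuleCat.{u} A}, (X ≃ₗ[A] Y) →
    FilteredBy C p Y) ?_ ?_ h
  · intro X hX Y e
    have : Subsingleton Y := e.symm.injective.subsingleton
    exact .of_subsingleton Y
  · intro X' X i f g hi hf hfg hg h' _ Y e
    refine h'.extend hi (f := e.toLinearMap ∘ₗ f) (g := g ∘ₗ e.symm.toLinearMap)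
      (e.injective.comp hf) ?_ (hg.comp e.symm.surjective)
    intro y
    simp only [LinearMap.comp_apply, LinearEquiv.coe_coe, hfg (e.symm y), Set.mem_range]
    exact exists_congr fun z => by rw [LinearEquiv.eq_symm_apply]

lemma FilteredBy.of_exact {X' X X'' : ModuleCat.{u} A} {f : X' →ₗ[A] X} {g : X →ₗ[A] X''}
    (hf : Function.Injective f) (hfg : Function.Exact f g) (hg : Function.Surjective g)
    (h' : FilteredBy C p X') (h'' : FilteredBy C p X'') : FilteredBy C p X := by
  revert X
  refine FilteredBy.induction (motive := fun X'' => ∀ {X : ModuleCat.{u} A} {f : X' →ₗ[A] X}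
    {g : X →ₗ[A] X''}, Function.Injective f → Function.Exact f g → Function.Surjective g →
    FilteredBy C p X) ?_ ?_ h''
  · intro X'' _ X f g hf hfg hg
    refine h'.of_equiv (LinearEquiv.ofBijective f ⟨hf, fun x => ?_⟩)
    exact (hfg x).1 (Subsingleton.elim _ _)
  · intro Y X'' i a b hi ha hab hb _ ih X f g hf hfg hg
    -- Here `X''` is an extension of `C i` by `Y`. The kernel `N` of `X → C i` is an extension of
    -- `Y` by `X'`, so it is filtered by induction, and `X` adds the factor `C i`.
    let N : Submodule A X := LinearMap.ker (b ∘ₗ g)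
    have hN : ∀ x : N, ∃ y, a y = g x := fun x => (hab (g x)).1 x.2
    choose φ hφ using hN
    let g' : N →ₗ[A] Y :=
      { toFun := φ
        map_add' := fun x y => ha (by simp [hφ])
        map_smul' := fun r x => ha (by simp [hφ]) }
    have hfN : ∀ x, f x ∈ N := fun x => by
      simp [N, hfg.apply_apply_eq_zero]
    have h1 : FilteredBy C p (ModuleCat.of A N) := by
      refine ih (f := f.codRestrict N hfN) (g := g') ?_ ?_ ?_
      · intro x y hxy
        exact hf (congrArg Subtype.val hxy)
      · intro x
        have : g' x = 0 ↔ g x = 0 := by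
          rw [← hφ x]
          exact (map_eq_zero_iff a ha).symm
        rw [this, hfg]
        exact exists_congr fun z => ⟨fun h => Subtype.ext h, congrArg Subtype.val⟩
      · intro y
        obtain ⟨x, hx⟩ := hg (a y)
        exact ⟨⟨x, by simp [N, hx, hab.apply_apply_eq_zero]⟩, ha ((hφ _).trans hx)⟩
    refine h1.extend hi (f := N.subtype) (g := b ∘ₗ g) N.injective_subtype ?_ (hb.comp hg)
    intro x
    simp [N]

lemma FilteredBy.single {i : ι} (hi : p i) : FilteredBy C p (C i) :=
  FilteredBy.extend (X' := ModuleCat.of A PUnit) (f := 0) (g := LinearMap.id) hi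
    (Function.injective_of_subsingleton _)
    (fun x => by simp [eq_comm])
    Function.surjective_id (.of_subsingleton _)

lemma FilteredBy.prod {X Y : ModuleCat.{u} A} (hX : FilteredBy C p X) (hY : FilteredBy C p Y) :
    FilteredBy C p (ModuleCat.of A (X × Y)) :=
  FilteredBy.of_exact (X := ModuleCat.of A (X × Y)) (f := LinearMap.inl A X Y)
    (g := LinearMap.snd A X Y)
    LinearMap.inl_injective Function.Exact.inl_snd LinearMap.snd_surjective hX hY

lemma FilteredBy.mono {q : ι → Prop} (hpq : ∀ i, p i → q i) {X : ModuleCat.{u} A}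
    (h : FilteredBy C p X) : FilteredBy C q X := by
  obtain ⟨s, N, h0, hs, hN⟩ := h
  refine ⟨s, N, h0, hs, fun k hk => ?_⟩
  obtain ⟨hle, i, hi, e⟩ := hN k hk
  exact ⟨hle, i, hpq i hi, e⟩

lemma FilteredBy.finite (hC : ∀ i, p i → Module.Finite A (C i))
    {X : ModuleCat.{u} A} (h : FilteredBy C p X) : Module.Finite A X := by
  refine FilteredBy.induction (motive := fun X => Module.Finite A X) ?_ ?_ h
  · intro X _
    infer_instance
  · intro X' X i f g hi hf hfg hg _ h'
    have := hC i hi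
    exact Module.Finite.of_exact hfg hg

/-- Maps out of a filtered module vanish if they vanish on all factors. -/
lemma FilteredBy.hom_eq_zero {Y : ModuleCat.{u} A}
    (hC : ∀ i, p i → ∀ f : C i →ₗ[A] Y, f = 0)
    {X : ModuleCat.{u} A} (h : FilteredBy C p X) (φ : X →ₗ[A] Y) : φ = 0 := by
  revert φ
  refine FilteredBy.induction (motive := fun X => ∀ φ : X →ₗ[A] Y, φ = 0) ?_ ?_ h
  · intro X _ φ
    exact LinearMap.ext fun x => by rw [Subsingleton.elim x 0, map_zero, map_zero]
  · intro X' X i f g hi hf hfg hg _ h' φ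
    have h1 := h' (φ ∘ₗ f)
    have hk : LinearMap.ker g ≤ LinearMap.ker φ := by
      intro x hx
      obtain ⟨y, rfl⟩ := (hfg x).1 hx
      exact LinearMap.congr_fun h1 y
    have h2 := hC i hi ((LinearMap.ker g).liftQ φ hk ∘ₗ
      (g.quotKerEquivOfSurjective hg).symm.toLinearMap)
    ext x
    have := LinearMap.congr_fun h2 (g x)
    rwa [LinearMap.comp_apply, LinearEquiv.coe_coe,
      (LinearEquiv.symm_apply_eq _).2 (g.quotKerEquivOfSurjective_apply_mk hg x).symm] at this

end Filtered

/-! ### Indecomposability, idempotents and local endomorphism rings. -/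

section Indecomposable

variable {A : Type u} [Ring A]

lemma isZero_iff_subsingleton (X : ModuleCat.{u} A) : Limits.IsZero X ↔ Subsingleton X := by
  refine ⟨fun h => ⟨fun x y => ?_⟩, fun h => ModuleCat.isZero_of_subsingleton X⟩
  have h1 : (𝟙 X : X ⟶ X) = 0 := h.eq_of_src _ _
  have h2 := fun x : X => LinearMap.congr_fun (congrArg ModuleCat.Hom.hom h1) x
  exact (h2 x).trans (h2 y).symm

lemma nontrivial_of_indecomposable {X : ModuleCat.{u} A} (h : Indecomposable X) :
    Nontrivial X := by
  rw [← not_subsingleton_iff_nontrivial, ← isZero_iff_subsingleton]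
  exact h.1

lemma eq_bot_or_eq_bot_of_isCompl {X : ModuleCat.{u} A} (h : Indecomposable X)
    {N N' : Submodule A X} (hN : IsCompl N N') : N = ⊥ ∨ N' = ⊥ := by
  have e : X ≅ ModuleCat.of A N ⊞ ModuleCat.of A N' :=
    (Submodule.prodEquivOfIsCompl N N' hN).symm.toModuleIso ≪≫
      (ModuleCat.biprodIsoProd (ModuleCat.of A N) (ModuleCat.of A N')).symm
  refine (h.2 _ _ e).imp ?_ ?_ <;>
  · rw [isZero_iff_subsingleton]
    exact (Submodule.subsingleton_iff_eq_bot).1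

lemma eq_zero_or_eq_one_of_isIdempotentElem {X : ModuleCat.{u} A} (h : Indecomposable X)
    {e : Module.End A X} (he : IsIdempotentElem e) : e = 0 ∨ e = 1 := by
  rcases eq_bot_or_eq_bot_of_isCompl h (LinearMap.IsIdempotentElem.isCompl he) with h | h
  · left
    exact LinearMap.range_eq_bot.1 h
  · right
    ext x
    exact LinearMap.ker_eq_bot.1 h (LinearMap.congr_fun he x)

lemma indecomposable_of_isIdempotentElem {X : ModuleCat.{u} A} [Nontrivial X]
    (h : ∀ e : Module.End A X, IsIdempotentElem e → e = 0 ∨ e = 1) : Indecomposable X := by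
  refine ⟨by rwa [isZero_iff_subsingleton, not_subsingleton_iff_nontrivial], fun Y Z i => ?_⟩
  let e : X ⟶ X := i.hom ≫ Limits.biprod.fst ≫ Limits.biprod.inl ≫ i.inv
  have he : e ≫ e = e := by simp [e]
  have hY : 𝟙 Y = Limits.biprod.inl ≫ i.inv ≫ e ≫ i.hom ≫ Limits.biprod.fst := by simp [e]
  have hZ : Limits.biprod.inr ≫ i.inv ≫ e ≫ i.hom ≫ Limits.biprod.snd = 0 := by simp [e]
  rcases h e.hom (congrArg ModuleCat.Hom.hom he) with h0 | h1
  · left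
    have : e = 0 := ModuleCat.hom_ext h0
    rw [Limits.IsZero.iff_id_eq_zero, hY, this]
    simp
  · right
    have : e = 𝟙 X := ModuleCat.hom_ext h1
    rw [this] at hZ
    rw [Limits.IsZero.iff_id_eq_zero, ← hZ]
    simp

/-- The endomorphism ring of an indecomposable module of finite length is local. -/
lemma isLocalRing_end_of_indecomposable {X : ModuleCat.{u} A} [IsArtinian A X] [IsNoetherian A X]
    (h : Indecomposable X) : IsLocalRing (Module.End A X) := by
  have := nontrivial_of_indecomposable h
  refine IsLocalRing.of_isUnit_or_isUnit_one_sub_self fun f => ?_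
  -- Fitting's lemma: for large `n` the kernel and range of `f ^ n` are complementary. The bound `1
  -- ≤ n` is what lets injectivity of `f ^ n` pass to `f`.
  obtain ⟨n, hn, hn1⟩ := (f.eventually_isCompl_ker_pow_range_pow.and
    (Filter.eventually_ge_atTop 1)).exists
  rcases eq_bot_or_eq_bot_of_isCompl h hn with h | h
  · left
    have hf : Function.Injective f := by
      have h1 := LinearMap.ker_eq_bot.1 h
      obtain ⟨m, rfl⟩ : ∃ m, n = m + 1 := ⟨n - 1, by omega⟩
      rw [pow_succ] at h1
      exact Function.Injective.of_comp h1
    exact (Module.End.isUnit_iff f).2 (IsArtinian.bijective_of_injective_endomorphism f hf)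
  · right
    exact IsNilpotent.isUnit_one_sub ⟨n, LinearMap.range_eq_bot.1 h⟩

end Indecomposable

/-! ### Additive closures, by factoring the identity. -/

section Through

variable {A : Type u} [Ring A] {ι : Type} (M : ι → ModuleCat.{u} A)

/-- The group of sums of maps `X → Y` that factor through a member of the family `M`. -/
def through (X Y : ModuleCat.{u} A) : AddSubgroup (X →ₗ[A] Y) :=
  AddSubgroup.closure {h | ∃ (i : ι) (f : X →ₗ[A] M i) (g : M i →ₗ[A] Y), h = g ∘ₗ f}

variable {M}

lemma comp_mem_through_of_factor {X Y : ModuleCat.{u} A} {i : ι} (f : X →ₗ[A] M i)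
    (g : M i →ₗ[A] Y) : g ∘ₗ f ∈ through M X Y :=
  AddSubgroup.subset_closure ⟨i, f, g, rfl⟩

lemma comp_mem_through_left {X Y Z : ModuleCat.{u} A} {f : X →ₗ[A] Y} (hf : f ∈ through M X Y)
    (g : Y →ₗ[A] Z) : g ∘ₗ f ∈ through M X Z := by
  refine AddSubgroup.closure_induction ?_ ?_ ?_ ?_ hf
  · rintro _ ⟨i, a, b, rfl⟩
    exact comp_mem_through_of_factor a (g ∘ₗ b)
  · simp [zero_mem]
  · intro a b _ _ ha hb
    rw [LinearMap.comp_add]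
    exact add_mem ha hb
  · intro a _ ha
    rw [LinearMap.comp_neg]
    exact neg_mem ha

lemma comp_mem_through_right {X Y Z : ModuleCat.{u} A} (f : X →ₗ[A] Y) {g : Y →ₗ[A] Z}
    (hg : g ∈ through M Y Z) : g ∘ₗ f ∈ through M X Z := by
  refine AddSubgroup.closure_induction ?_ ?_ ?_ ?_ hg
  · rintro _ ⟨i, a, b, rfl⟩
    exact comp_mem_through_of_factor (a ∘ₗ f) b
  · simp [zero_mem]
  · intro a b _ _ ha hb
    rw [LinearMap.add_comp]
    exact add_mem ha hb
  · intro a _ ha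
    rw [LinearMap.neg_comp]
    exact neg_mem ha

lemma id_mem_through_of_retract {X Y : ModuleCat.{u} A} (s : X →ₗ[A] Y) (r : Y →ₗ[A] X)
    (h : r ∘ₗ s = LinearMap.id) (hY : LinearMap.id ∈ through M Y Y) :
    LinearMap.id ∈ through M X X := by
  rw [← h]
  simpa using comp_mem_through_right s (comp_mem_through_left hY r)

lemma id_mem_through_self (i : ι) : LinearMap.id ∈ through M (M i) (M i) :=
  comp_mem_through_of_factor (M := M) (i := i) LinearMap.id LinearMap.id

lemma id_mem_through_prod {X Y : ModuleCat.{u} A} (hX : LinearMap.id ∈ through M X X)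
    (hY : LinearMap.id ∈ through M Y Y) :
    LinearMap.id ∈ through M (ModuleCat.of A (X × Y)) (ModuleCat.of A (X × Y)) := by
  have h1 := comp_mem_through_right (X := ModuleCat.of A (X × Y)) (LinearMap.fst A X Y)
    (comp_mem_through_left (Z := ModuleCat.of A (X × Y)) hX (LinearMap.inl A X Y))
  have h2 := comp_mem_through_right (X := ModuleCat.of A (X × Y)) (LinearMap.snd A X Y)
    (comp_mem_through_left (Z := ModuleCat.of A (X × Y)) hY (LinearMap.inr A X Y))
  convert add_mem h1 h2
  ext x <;> simp

lemma id_mem_through_of_subsingleton (X : ModuleCat.{u} A) [Subsingleton X] :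
    LinearMap.id ∈ through M X X := by
  rw [Subsingleton.elim (LinearMap.id : X →ₗ[A] X) 0]
  exact zero_mem _

lemma id_mem_through_pi [Finite ι] : LinearMap.id ∈ through M (finSum M) (finSum M) := by
  classical
  have := Fintype.ofFinite ι
  have h : (LinearMap.id : (∀ i, M i) →ₗ[A] (∀ i, M i)) =
      ∑ i, LinearMap.single A (fun i => M i) i ∘ₗ LinearMap.proj i := by
    ext i x j
    simp
  have h' : (LinearMap.id : finSum M →ₗ[A] finSum M) =
      ∑ i, LinearMap.single A (fun i => M i) i ∘ₗ LinearMap.proj i := h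
  rw [h']
  exact sum_mem fun i _ => comp_mem_through_of_factor (M := M) (i := i) _ _

/-- Inserting the identity of `M i`, itself a sum of maps through the `N k`, refines every map
through `M i`. -/
lemma through_mono {κ : Type} {N : κ → ModuleCat.{u} A}
    (h : ∀ i, LinearMap.id ∈ through N (M i) (M i)) (X Y : ModuleCat.{u} A) :
    through M X Y ≤ through N X Y := by
  refine (AddSubgroup.closure_le _).2 ?_
  rintro _ ⟨i, f, g, rfl⟩
  simpa using comp_mem_through_right f (comp_mem_through_left (h i) g)

/-- An indecomposable module of finite length which is a direct summand of a finite direct sum of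
indecomposable modules is isomorphic to one of these. -/
lemma exists_equiv_of_id_mem_through (hM : ∀ i, Indecomposable (M i)) {X : ModuleCat.{u} A}
    [IsArtinian A X] [IsNoetherian A X] (hX : Indecomposable X)
    (h : LinearMap.id ∈ through M X X) : ∃ i, Nonempty (X ≃ₗ[A] M i) := by
  have := isLocalRing_end_of_indecomposable hX
  have hnt := nontrivial_of_indecomposable hX
  -- Nonunits of a local ring are closed under sums and the identity is a unit, so some single
  -- composite through an `M i` is already invertible.
  obtain ⟨i, f, g, hu⟩ : ∃ (i : ι) (f : X →ₗ[A] M i) (g : M i →ₗ[A] X),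
      IsUnit (show Module.End A X from g ∘ₗ f) := by
    by_contra! hne
    have hle : ∀ a ∈ through M X X, (show Module.End A X from a) ∈ nonunits (Module.End A X) := by
      intro a ha
      refine AddSubgroup.closure_induction ?_ ?_ ?_ ?_ ha
      · rintro _ ⟨i, f, g, rfl⟩
        exact hne i f g
      · exact not_isUnit_zero
      · intro a b _ _ ha hb
        exact IsLocalRing.nonunits_add ha hb
      · intro a _ ha hn
        exact ha ((IsUnit.neg_iff a).1 hn)
    exact hle _ h isUnit_one
  obtain ⟨v, hv⟩ := hu.exists_left_inv
  have hvf : ∀ x, v (g (f x)) = x := fun x => LinearMap.congr_fun hv x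
  -- As `v ∘ g` is a retraction of `f`, the image of `f` is a direct summand of the indecomposable
  -- `M i`; it is nonzero, hence everything.
  have hcompl : IsCompl (LinearMap.range f) (LinearMap.ker (v ∘ₗ g)) := by
    refine ⟨Submodule.disjoint_def.2 ?_, codisjoint_iff.2 (Submodule.eq_top_iff'.2 fun y => ?_)⟩
    · rintro _ ⟨x, rfl⟩ hx
      have hx' : v (g (f x)) = 0 := hx
      rw [hvf] at hx'
      rw [hx', map_zero]
    · refine Submodule.mem_sup.2 ⟨f (v (g y)), ⟨_, rfl⟩, y - f (v (g y)), ?_, by abel⟩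
      simp [hvf]
  rcases eq_bot_or_eq_bot_of_isCompl (hM i) hcompl with hb | hb
  · exfalso
    obtain ⟨x, hx⟩ := exists_ne (0 : X)
    apply hx
    rw [← hvf x, LinearMap.range_eq_bot.1 hb]
    simp
  · refine ⟨i, ⟨LinearEquiv.ofBijective f ⟨Function.LeftInverse.injective (g := v ∘ₗ g) hvf, ?_⟩⟩⟩
    rw [hb] at hcompl
    exact LinearMap.range_eq_top.1 (eq_top_of_isCompl_bot hcompl)

/-- For a general family `C`, `𝓕(C)` is not closed under direct summands, so `X` is split by
idempotents, with induction on length, down to indecomposables; each of those is isomorphic to some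
`M i`. -/
lemma FilteredBy.of_id_mem_through {κ : Type} {C : κ → ModuleCat.{u} A} {p : κ → Prop}
    (hM : ∀ i, Indecomposable (M i)) (hC : ∀ i, FilteredBy C p (M i)) (X : ModuleCat.{u} A)
    [IsArtinian A X] [IsNoetherian A X] (h : LinearMap.id ∈ through M X X) :
    FilteredBy C p X := by
  obtain ⟨n, hn⟩ : ∃ n : ℕ, Module.length A X = n :=
    ⟨_, (ENat.natCast_toNat Module.length_ne_top).symm⟩
  induction n using Nat.strong_induction_on generalizing X with
  | _ n ih =>
    rcases subsingleton_or_nontrivial X with hs | hs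
    · exact .of_subsingleton X
    by_cases hX : Indecomposable X
    · obtain ⟨i, ⟨e⟩⟩ := exists_equiv_of_id_mem_through hM hX h
      exact (hC i).of_equiv e.symm
    · have : ∃ e : Module.End A X, IsIdempotentElem e ∧ e ≠ 0 ∧ e ≠ 1 := by
        by_contra! hcon
        refine hX (indecomposable_of_isIdempotentElem fun e he => ?_)
        by_cases h0 : e = 0
        · exact Or.inl h0
        · exact Or.inr (hcon e he h0)
      obtain ⟨e, he, h0, h1⟩ := this
      have hc := LinearMap.IsIdempotentElem.isCompl he
      have hlt : ∀ N N' : Submodule A X, IsCompl N N' → N ≠ ⊤ →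
          FilteredBy C p (ModuleCat.of A N) := by
        intro N N' hc hN
        have hl : Module.length A N < Module.length A X := Submodule.length_lt hN
        have hN' : IsArtinian A (ModuleCat.of A N) := inferInstanceAs (IsArtinian A N)
        have hN'' : IsNoetherian A (ModuleCat.of A N) := inferInstanceAs (IsNoetherian A N)
        obtain ⟨m, hm⟩ : ∃ m : ℕ, Module.length A N = m :=
          ⟨_, (ENat.natCast_toNat Module.length_ne_top).symm⟩
        refine ih m ?_ (ModuleCat.of A N) ?_ hm
        · rw [hm, hn] at hl
          exact_mod_cast hl
        · refine id_mem_through_of_retract (X := ModuleCat.of A N) N.subtype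
            (Submodule.projectionOnto N N' hc) ?_ h
          exact LinearMap.ext fun x => Submodule.projectionOnto_apply_left hc x
      have hr : LinearMap.range e ≠ ⊤ := by
        intro hr
        rw [hr] at hc
        refine h1 (LinearMap.ext fun x => ?_)
        exact LinearMap.ker_eq_bot.1 (eq_bot_of_top_isCompl hc) (LinearMap.congr_fun he x)
      have hk : LinearMap.ker e ≠ ⊤ := fun hk => h0 (LinearMap.ker_eq_top.1 hk)
      exact ((hlt _ _ hc hr).prod (hlt _ _ hc.symm hk)).of_equiv
        (Submodule.prodEquivOfIsCompl _ _ hc)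

/-- The members of `add (⨁ M i)` are the modules whose identity is a sum of maps through the
`M i`. -/
lemma addClosure_finSum_iff [Finite ι] (X : ModuleCat.{u} A) :
    AddClosure (finSum M) X ↔ LinearMap.id ∈ through M X X := by
  classical
  have := Fintype.ofFinite ι
  constructor
  · rintro ⟨n, Y, ⟨e⟩⟩
    have h : LinearMap.id ∈ through M (finSum fun _ : Fin n => finSum M)
        (finSum fun _ : Fin n => finSum M) :=
      through_mono (M := fun _ : Fin n => finSum M) (fun _ => id_mem_through_pi) _ _
        id_mem_through_pi
    refine id_mem_through_of_retract (e.toLinearMap ∘ₗ LinearMap.inl A X Y)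
      (LinearMap.fst A X Y ∘ₗ e.symm.toLinearMap) ?_ h
    ext x
    change (e.symm (e (x, 0))).1 = x
    simp
  · intro h
    -- A sum of maps through powers of `finSum M` factors through one power: the exponents add, and
    -- `f.prod f'`, `g.coprod g'` combine the factors.
    have key : ∀ a ∈ through M X X, ∃ (n : ℕ) (f : X →ₗ[A] (Fin n → finSum M))
        (g : (Fin n → finSum M) →ₗ[A] X), a = g ∘ₗ f := by
      intro a ha
      refine AddSubgroup.closure_induction ?_ ?_ ?_ ?_ ha
      · rintro _ ⟨i, f, g, rfl⟩
        refine ⟨1, LinearMap.pi fun _ => LinearMap.single A (fun i => M i) i ∘ₗ f,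
          (g ∘ₗ LinearMap.proj i) ∘ₗ LinearMap.proj 0, ?_⟩
        ext x
        change g (f x) = g (Pi.single (M := fun i => M i) i (f x) i)
        rw [Pi.single_eq_same]
      · exact ⟨0, 0, 0, by simp⟩
      · rintro a b _ _ ⟨n, f, g, rfl⟩ ⟨m, f', g', rfl⟩
        refine ⟨n + m, (LinearEquiv.piCongrLeft A (fun _ => finSum M) finSumFinEquiv).toLinearMap ∘ₗ
          (LinearEquiv.sumPiEquivProdPi A (Fin n) (Fin m) (fun _ => finSum M)).symm.toLinearMap ∘ₗ
            (f.prod f'), (g.coprod g') ∘ₗ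
          (LinearEquiv.sumPiEquivProdPi A (Fin n) (Fin m) (fun _ => finSum M)).toLinearMap ∘ₗ
          (LinearEquiv.piCongrLeft A (fun _ => finSum M) finSumFinEquiv).symm.toLinearMap, ?_⟩
        ext x
        simp
      · rintro a _ ⟨n, f, g, rfl⟩
        exact ⟨n, f, -g, by simp [LinearMap.neg_comp]⟩
    obtain ⟨n, f, g, hfg⟩ := key _ h
    have hgf : ∀ x, g (f x) = x := fun x => (LinearMap.congr_fun hfg x).symm
    refine ⟨n, ModuleCat.of A (LinearMap.ker g), ⟨LinearEquiv.ofBijective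
      (f.coprod (LinearMap.ker g).subtype) ⟨?_, ?_⟩⟩⟩
    · rw [injective_iff_map_eq_zero]
      rintro ⟨x, y, hy⟩ hxy
      have h0 : f x + y = 0 := hxy
      have h1 : x = 0 := by
        have := congrArg g h0
        rwa [map_add, hgf, LinearMap.mem_ker.1 hy, add_zero, map_zero] at this
      subst h1
      rw [map_zero, zero_add] at h0
      subst h0
      rfl
    · intro z
      exact ⟨(g z, ⟨z - f (g z), by simp [hgf]⟩), by simp⟩

end Through

/-! ### Vanishing of `Ext¹`: lifting, extensions, summands. -/

section Ext

variable {A : Type u} [Ring A]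

lemma shortExact_of_exact {X₁ X₂ X₃ : ModuleCat.{u} A} {f : X₁ →ₗ[A] X₂} {g : X₂ →ₗ[A] X₃}
    (hf : Function.Injective f) (hfg : Function.Exact f g) (hg : Function.Surjective g) :
    (ShortComplex.mk (ModuleCat.ofHom f) (ModuleCat.ofHom g)
      (ModuleCat.hom_ext hfg.linearMap_comp_eq_zero)).ShortExact where
  exact := (ShortComplex.ShortExact.moduleCat_exact_iff_function_exact _).2 hfg
  mono_f := (ModuleCat.mono_iff_injective _).2 hf
  epi_g := (ModuleCat.epi_iff_surjective _).2 hg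

/-- The obstruction to lifting `φ` is its image under the connecting map, which lies in `Ext¹(X, X₁)
= 0`. -/
lemma ExtOneVanishes.exists_lift {X X₁ X₂ X₃ : ModuleCat.{u} A} (h : ExtOneVanishes X X₁)
    {f : X₁ →ₗ[A] X₂} {g : X₂ →ₗ[A] X₃} (hf : Function.Injective f) (hfg : Function.Exact f g)
    (hg : Function.Surjective g) (φ : X →ₗ[A] X₃) : ∃ ψ : X →ₗ[A] X₂, g ∘ₗ ψ = φ := by
  have hS := shortExact_of_exact hf hfg hg
  obtain ⟨x, hx⟩ := Abelian.Ext.covariant_sequence_exact₃ X hS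
    (Abelian.Ext.mk₀ (ModuleCat.ofHom φ)) (zero_add 1) (h.elim _ _)
  obtain ⟨ψ, rfl⟩ := Abelian.Ext.mk₀_bijective X X₂ |>.surjective x
  rw [Abelian.Ext.mk₀_comp_mk₀] at hx
  exact ⟨ψ.hom, congrArg ModuleCat.Hom.hom ((Abelian.Ext.mk₀_bijective X X₃).injective hx)⟩

lemma ExtOneVanishes.of_exact {X X₁ X₂ X₃ : ModuleCat.{u} A} {f : X₁ →ₗ[A] X₂}
    {g : X₂ →ₗ[A] X₃} (hf : Function.Injective f) (hfg : Function.Exact f g)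
    (hg : Function.Surjective g) (h₁ : ExtOneVanishes X X₁) (h₃ : ExtOneVanishes X X₃) :
    ExtOneVanishes X X₂ := by
  have hS := shortExact_of_exact hf hfg hg
  refine subsingleton_of_forall_eq 0 fun x => ?_
  obtain ⟨y, rfl⟩ := Abelian.Ext.covariant_sequence_exact₂ X hS x (h₃.elim _ _)
  rw [h₁.elim y 0, Abelian.Ext.zero_comp]

lemma ExtOneVanishes.of_subsingleton (X Y : ModuleCat.{u} A) [Subsingleton Y] :
    ExtOneVanishes X Y := by
  refine subsingleton_of_forall_eq 0 fun x => ?_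
  have h : 𝟙 Y = 0 := (ModuleCat.isZero_of_subsingleton Y).eq_of_src _ _
  rw [← x.comp_mk₀_id, h, Abelian.Ext.mk₀_zero, Abelian.Ext.comp_zero]

lemma ExtOneVanishes.of_filteredBy {ι : Type} {C : ι → ModuleCat.{u} A} {p : ι → Prop}
    {X Y : ModuleCat.{u} A} (hC : ∀ i, p i → ExtOneVanishes X (C i)) (hY : FilteredBy C p Y) :
    ExtOneVanishes X Y := by
  refine FilteredBy.induction (motive := fun Y => ExtOneVanishes X Y) ?_ ?_ hY
  · intro Y _
    exact .of_subsingleton X Y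
  · intro X' X'' i f g hi hf hfg hg _ h'
    exact .of_exact hf hfg hg h' (hC i hi)

/-- A map through `M i` acts as zero on `Ext¹(X, Y)`, because its action passes through `Ext¹(M i,
Y) = 0`. The identity is a sum of such maps. -/
lemma ExtOneVanishes.of_id_mem_through {ι : Type} {M : ι → ModuleCat.{u} A}
    {X Y : ModuleCat.{u} A} (hM : ∀ i, ExtOneVanishes (M i) Y)
    (h : LinearMap.id ∈ through M X X) : ExtOneVanishes X Y := by
  refine subsingleton_of_forall_eq 0 fun x => ?_
  have key : ∀ a ∈ through M X X,
      (Abelian.Ext.mk₀ (ModuleCat.ofHom a)).comp x (zero_add 1) = 0 := by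
    intro a ha
    refine AddSubgroup.closure_induction ?_ ?_ ?_ ?_ ha
    · rintro _ ⟨i, f, g, rfl⟩
      rw [ModuleCat.ofHom_comp, ← Abelian.Ext.mk₀_comp_mk₀_assoc,
        (hM i).elim (Abelian.Ext.comp _ x _) 0, Abelian.Ext.comp_zero]
    · have : ModuleCat.ofHom (0 : X →ₗ[A] X) = 0 := rfl
      rw [this, Abelian.Ext.mk₀_zero, Abelian.Ext.zero_comp]
    · intro a b _ _ ha hb
      have : ModuleCat.ofHom (a + b) = ModuleCat.ofHom a + ModuleCat.ofHom b := rfl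
      rw [this, Abelian.Ext.mk₀_add, Abelian.Ext.add_comp, ha, hb, add_zero]
    · intro a _ ha
      have : ModuleCat.ofHom (-a) = -ModuleCat.ofHom a := rfl
      rw [this, Abelian.Ext.mk₀_neg, Abelian.Ext.neg_comp, ha, neg_zero]
  rw [← x.mk₀_id_comp]
  exact key _ h

end Ext

/-! ### Covers by `add Q`, and statement (e). -/

namespace IsExtProjectiveStratifyingSystem

variable {A : Type u} [Ring A] {ι : Type} [Finite ι] [LinearOrder ι] {Θ Q : ι → ModuleCat.{u} A}

lemma filteredBy_Q (h : IsExtProjectiveStratifyingSystem Θ Q)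
    (i : ι) : FilteredBy Θ (fun j => i ≤ j) (Q i) := by
  obtain ⟨K, α, β, hα, hαβ, hβ, hK⟩ := h.exists_sequence i
  exact (hK.mono fun _ => le_of_lt).extend le_rfl hα hαβ hβ

lemma filtered_Q (h : IsExtProjectiveStratifyingSystem Θ Q) (i : ι) : Filtered Θ (Q i) :=
  (h.filteredBy_Q i).mono fun _ _ => trivial

lemma ext_Q_of_filtered (h : IsExtProjectiveStratifyingSystem Θ Q)
    (i : ι) {Y : ModuleCat.{u} A} (hY : Filtered Θ Y) :
    ExtOneVanishes (Q i) Y :=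
  .of_filteredBy (fun j _ => h.ext_vanishes i j) hY

lemma ext_finSum_of_filtered (h : IsExtProjectiveStratifyingSystem Θ Q)
    {Y : ModuleCat.{u} A} (hY : Filtered Θ Y) :
    ExtOneVanishes (finSum Q) Y :=
  .of_id_mem_through (fun i => h.ext_Q_of_filtered i hY) id_mem_through_pi

lemma hom_Q_theta_eq_zero (h : IsExtProjectiveStratifyingSystem Θ Q)
    {i j : ι} (hij : j < i) (φ : Q i →ₗ[A] Θ j) : φ = 0 :=
  (h.filteredBy_Q i).hom_eq_zero (fun k hk f => h.hom_eq_zero k j (hij.trans_le hk) f) φ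

lemma filteredBy_of_id_mem_through (h : IsExtProjectiveStratifyingSystem Θ Q)
    {X : ModuleCat.{u} A} [IsArtinian A X] [IsNoetherian A X]
    (hX : LinearMap.id ∈ through Q X X) : Filtered Θ X :=
  .of_id_mem_through h.indecomposable_Q h.filtered_Q X hX

/-- If `j < i`, all maps `Q i → Θ j` vanish, whereas `Q j` maps onto the nonzero module `Θ j`. -/
lemma eq_of_equiv_Q (h : IsExtProjectiveStratifyingSystem Θ Q)
    {i j : ι} (e : Q i ≃ₗ[A] Q j) : i = j := by
  have key : ∀ {i j : ι}, (Q i ≃ₗ[A] Q j) → ¬ j < i := by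
    intro i j e hij
    obtain ⟨K, α, β, hα, hαβ, hβ, hK⟩ := h.exists_sequence j
    have h0 := h.hom_Q_theta_eq_zero hij (β ∘ₗ e.toLinearMap)
    obtain ⟨x, hx⟩ := @exists_ne _ (h.nontrivial_theta j) 0
    obtain ⟨y, rfl⟩ := hβ x
    obtain ⟨z, rfl⟩ := e.surjective y
    exact hx (LinearMap.congr_fun h0 z)
  exact le_antisymm (not_lt.1 (key e)) (not_lt.1 (key e.symm))

/-- A module filtered by the `Θ j` with `p j`, for an upward closed `p`, has a cover by a module in
`add {Q j : p j}` whose kernel is filtered in the same way. -/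
lemma exists_cover (h : IsExtProjectiveStratifyingSystem Θ Q)
    {p : ι → Prop} (hp : ∀ i j, i ≤ j → p i → p j) {X : ModuleCat.{u} A}
    (hX : FilteredBy Θ p X) : ∃ (Z Y : ModuleCat.{u} A) (f : Z →ₗ[A] Y) (g : Y →ₗ[A] X),
      Function.Injective f ∧ Function.Exact f g ∧ Function.Surjective g ∧ FilteredBy Θ p Z ∧
      LinearMap.id ∈ through (fun j : {j // p j} => Q j) Y Y := by
  refine FilteredBy.induction (motive := fun X => ∃ (Z Y : ModuleCat.{u} A) (f : Z →ₗ[A] Y)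
    (g : Y →ₗ[A] X), Function.Injective f ∧ Function.Exact f g ∧ Function.Surjective g ∧
      FilteredBy Θ p Z ∧ LinearMap.id ∈ through (fun j : {j // p j} => Q j) Y Y) ?_ ?_ hX
  · intro X _
    refine ⟨X, X, LinearMap.id, LinearMap.id, Function.injective_id, fun x => ?_,
      Function.surjective_id, .of_subsingleton X, id_mem_through_of_subsingleton X⟩
    simp [Subsingleton.elim x 0]
  · rintro X' X i a b hi ha hab hb hX' ⟨Z, Y, f, g, hf, hfg, hg, hZ, hY⟩
    obtain ⟨K, α, β, hα, hαβ, hβ, hK⟩ := h.exists_sequence i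
    -- Horseshoe step: `β` lifts to `γ : Q i → X`, and together with the cover of `X'` it gives the
    -- cover `π` of `X` by `Y × Q i`.
    obtain ⟨γ, hγ⟩ := (h.ext_Q_of_filtered i (hX'.mono fun _ _ => trivial)).exists_lift
      ha hab hb β
    have hγ' : ∀ x, b (γ x) = β x := fun x => LinearMap.congr_fun hγ x
    let π : (Y × Q i) →ₗ[A] X := (a ∘ₗ g).coprod γ
    have hπ : ∀ y q, π (y, q) = a (g y) + γ q := fun y q => by simp [π]
    refine ⟨ModuleCat.of A (LinearMap.ker π), ModuleCat.of A (Y × Q i),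
      (LinearMap.ker π).subtype, π, Submodule.injective_subtype _, fun x => ?_, fun x => ?_, ?_,
      id_mem_through_prod hY (id_mem_through_self (M := fun j : {j // p j} => Q j) ⟨i, hi⟩)⟩
    · exact ⟨fun hx => ⟨⟨x, hx⟩, rfl⟩, by rintro ⟨y, rfl⟩; exact y.2⟩
    · obtain ⟨q, hq⟩ := hβ (b x)
      obtain ⟨x', hx'⟩ := (hab (x - γ q)).1 (by rw [map_sub, hγ', hq, sub_self])
      obtain ⟨y, rfl⟩ := hg x'
      exact ⟨(y, q), by rw [hπ, hx']; abel⟩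
    -- The kernel of `π` is an extension of `K` by `Z`. The factors `Θ j` of `K` have `j > i`, so
    -- they satisfy the upward closed condition `p`.
    · have hker : ∀ w : LinearMap.ker π, ∃ k, α k = w.1.2 := by
        rintro ⟨⟨y, q⟩, hw⟩
        refine (hαβ q).1 ?_
        have h1 : a (g y) + γ q = 0 := (hπ y q).symm.trans hw
        have h2 := congrArg b h1
        rwa [map_add, hab.apply_apply_eq_zero, zero_add, hγ', map_zero] at h2
      choose κ hκ using hker
      let c : LinearMap.ker π →ₗ[A] K :=
        { toFun := κ
          map_add' := fun x y => hα (by simp [hκ])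
          map_smul' := fun r x => hα (by simp [hκ]) }
      have hd : ∀ z, (LinearMap.inl A Y (Q i) ∘ₗ f) z ∈ LinearMap.ker π := fun z => by
        simp [π, hfg.apply_apply_eq_zero]
      refine FilteredBy.of_exact (X := ModuleCat.of A (LinearMap.ker π))
        (f := (LinearMap.inl A Y (Q i) ∘ₗ f).codRestrict (LinearMap.ker π) hd) (g := c) ?_ ?_ ?_
        hZ (hK.mono fun j hj => hp i j hj.le hi)
      · intro x y hxy
        exact hf (congrArg (fun w : LinearMap.ker π => w.1.1) hxy)
      · rintro ⟨⟨y, q⟩, hw⟩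
        have hc : c ⟨(y, q), hw⟩ = 0 ↔ q = 0 := by
          rw [← map_eq_zero_iff α hα]
          exact Eq.congr_left (hκ _)
        rw [hc]
        constructor
        · rintro rfl
          have h1 : a (g y) + γ 0 = 0 := (hπ y 0).symm.trans hw
          rw [map_zero, add_zero, map_eq_zero_iff a ha] at h1
          obtain ⟨z, rfl⟩ := (hfg y).1 h1
          exact ⟨z, rfl⟩
        · rintro ⟨z, hz⟩
          exact (congrArg (fun w : LinearMap.ker π => w.1.2) hz).symm
      · intro k
        have h1 : b (γ (α k)) = 0 := by rw [hγ', hαβ.apply_apply_eq_zero]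
        obtain ⟨x', hx'⟩ := (hab _).1 h1
        obtain ⟨y, rfl⟩ := hg x'
        exact ⟨⟨(-y, α k), by simp [π, hx']⟩, hα (hκ _)⟩

lemma exists_cover_of_filtered (h : IsExtProjectiveStratifyingSystem Θ Q)
    {X : ModuleCat.{u} A} (hX : Filtered Θ X) :
    ∃ (Z Y : ModuleCat.{u} A) (f : Z →ₗ[A] Y) (g : Y →ₗ[A] X),
      Function.Injective f ∧ Function.Exact f g ∧ Function.Surjective g ∧ Filtered Θ Z ∧
      LinearMap.id ∈ through Q Y Y := by
  obtain ⟨Z, Y, f, g, hf, hfg, hg, hZ, hY⟩ := h.exists_cover (fun _ _ _ _ => trivial) hX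
  exact ⟨Z, Y, f, g, hf, hfg, hg, hZ, through_mono (fun i => id_mem_through_self i.1) _ _ hY⟩

/-- `add (⨁ Q(i)) = 𝓕(Θ) ∩ ⊥₁𝓕(Θ)`. -/
lemma addClosure_eq (h : IsExtProjectiveStratifyingSystem Θ Q) [IsArtinianRing A] :
    AddClosure (finSum Q) = Filtered Θ ⊓ LeftPerpOne (Filtered Θ) := by
  ext X
  rw [addClosure_finSum_iff]
  constructor
  · intro hX
    have hfin : Module.Finite A X := by
      obtain ⟨n, Y, ⟨e⟩⟩ := (addClosure_finSum_iff X).2 hX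
      have := h.finite_Q
      have : Module.Finite A (finSum Q) := inferInstanceAs (Module.Finite A (∀ i, Q i))
      exact Module.Finite.of_surjective (LinearMap.fst A X Y ∘ₗ e.symm.toLinearMap)
        fun x => ⟨e (x, 0), by simp⟩
    exact ⟨h.filteredBy_of_id_mem_through hX, hfin,
      fun Y hY => .of_id_mem_through (fun i => h.ext_Q_of_filtered i hY) hX⟩
  · rintro ⟨hX, -, hX'⟩
    obtain ⟨Z, Y, f, g, hf, hfg, hg, hZ, hY⟩ := h.exists_cover_of_filtered hX
    -- Since `Ext¹(X, Z) = 0`, the identity of `X` lifts and the cover splits.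
    obtain ⟨s, hs⟩ := (hX' Z hZ).exists_lift hf hfg hg LinearMap.id
    exact id_mem_through_of_retract s g hs hY

end IsExtProjectiveStratifyingSystem

/-! ### The adjunction between `M ⊗_Γ -` and `Hom(M, -)`. -/

section Adjunction

variable {Λ : Type u} [Ring Λ] (M : ModuleCat.{u} Λ)

variable {M} in
/-- The element `m ⊗ y` of `M ⊗_Γ Y`. -/
def tensorMk {Y : ModuleCat.{u} (EndOp M)} (m : M) (y : Y) : (tensorFunctor M).obj Y :=
  Submodule.Quotient.mk (m ⊗ₜ[ℤ] y)

lemma tensorMk_add_left {Y : ModuleCat.{u} (EndOp M)} (m m' : M) (y : Y) :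
    tensorMk (m + m') y = tensorMk m y + tensorMk m' y := by
  rw [tensorMk, TensorProduct.add_tmul]
  rfl

lemma tensorMk_add_right {Y : ModuleCat.{u} (EndOp M)} (m : M) (y y' : Y) :
    tensorMk m (y + y') = tensorMk m y + tensorMk m y' := by
  rw [tensorMk, TensorProduct.tmul_add]
  rfl

lemma tensorMk_smul_right {Y : ModuleCat.{u} (EndOp M)} (m : M) (γ : EndOp M) (y : Y) :
    tensorMk m (γ • y) = tensorMk (γ.unop m) y :=
  ((Submodule.Quotient.eq (balancedRel M Y)).2 (Submodule.subset_span ⟨m, γ, y, rfl⟩)).symm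

variable {M} in
@[elab_as_elim]
lemma tensor_induction {Y : ModuleCat.{u} (EndOp M)} {motive : (tensorFunctor M).obj Y → Prop}
    (zero : motive 0) (mk : ∀ m y, motive (tensorMk m y))
    (add : ∀ x y, motive x → motive y → motive (x + y)) (z : (tensorFunctor M).obj Y) :
    motive z := by
  obtain ⟨z, rfl⟩ := Submodule.Quotient.mk_surjective _ z
  induction z using TensorProduct.induction_on with
  | zero => exact zero
  | tmul m y => exact mk m y
  | add x y hx hy => exact add _ _ hx hy

variable {M} in
lemma tensor_hom_ext {Y : ModuleCat.{u} (EndOp M)} {X : ModuleCat.{u} Λ}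
    {f g : (tensorFunctor M).obj Y ⟶ X}
    (h : ∀ m y, f.hom (tensorMk m y) = g.hom (tensorMk m y)) : f = g := by
  refine ModuleCat.hom_ext (LinearMap.ext fun z => ?_)
  induction z using tensor_induction with
  | zero => rw [map_zero, map_zero]
  | mk m y => exact h m y
  | add x y hx hy => rw [map_add, map_add, hx, hy]

/-- The evaluation map `M ⊗_Γ Hom(M, X) → X`. -/
def evalMap (X : ModuleCat.{u} Λ) :
    (tensorFunctor M).obj ((homFunctor M).obj X) →ₗ[Λ] X :=
  Submodule.liftQ _ (TensorProduct.AlgebraTensorModule.lift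
    { toFun := fun m =>
        { toFun := fun h : M →ₗ[Λ] X => h m
          map_add' := fun _ _ => rfl
          map_smul' := fun _ _ => rfl }
      map_add' := fun m m' => LinearMap.ext fun h : M →ₗ[Λ] X => map_add h m m'
      map_smul' := fun r m => LinearMap.ext fun h : M →ₗ[Λ] X => map_smul h r m }) (by
    refine Submodule.span_le.2 ?_
    rintro _ ⟨m, γ, y, rfl⟩
    rw [SetLike.mem_coe, LinearMap.mem_ker, map_sub]
    exact sub_self (G := X) ((show M →ₗ[Λ] X from y) (γ.unop m)))

/-- The map `Y → Hom(M, M ⊗_Γ Y)`. -/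
def coevalMap (Y : ModuleCat.{u} (EndOp M)) :
    Y →ₗ[EndOp M] (homFunctor M).obj ((tensorFunctor M).obj Y) where
  toFun y := show M →ₗ[Λ] (tensorFunctor M).obj Y from
    { toFun := fun m => tensorMk m y
      map_add' := fun m m' => tensorMk_add_left M m m' y
      map_smul' := fun _ _ => rfl }
  map_add' y y' := LinearMap.ext fun m => tensorMk_add_right M m y y'
  map_smul' γ y := LinearMap.ext fun m => tensorMk_smul_right M m γ y

/-- The adjunction between `M ⊗_Γ -` and `Hom(M, -)`. -/
def tensorHomAdjunction : tensorFunctor M ⊣ homFunctor M :=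
  Adjunction.mkOfUnitCounit
    { unit :=
        { app := fun Y => ModuleCat.ofHom (coevalMap M Y)
          naturality := fun _ _ _ => rfl }
      counit :=
        { app := fun X => ModuleCat.ofHom (evalMap M X)
          naturality := fun _ _ _ => tensor_hom_ext fun _ _ => rfl }
      left_triangle := by
        ext Y : 2
        exact tensor_hom_ext fun _ _ => rfl
      right_triangle := by
        ext X : 2
        rfl }

instance : (tensorFunctor M).Additive where
  map_add {_ _ _ _} := tensor_hom_ext fun m _ => tensorMk_add_right M m _ _

/-- Generators `y ∈ s` of `Y` give a map `M^s → M ⊗_Γ Y`; it is onto because coefficients from `Γ`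
move across the tensor sign to `M`. -/
lemma finite_tensorFunctor_obj [Module.Finite Λ M] (Y : ModuleCat.{u} (EndOp M))
    [hY : Module.Finite (EndOp M) Y] : Module.Finite Λ ((tensorFunctor M).obj Y) := by
  classical
  obtain ⟨s, hs⟩ := hY.fg_top
  let c : s → M →ₗ[Λ] (tensorFunctor M).obj Y := fun y => coevalMap M Y y.1
  let φ : (s → M) →ₗ[Λ] (tensorFunctor M).obj Y := LinearMap.lsum Λ (fun _ : s => M) ℕ c
  have hφ : ∀ (y : s) (m : M), φ (Pi.single y m) = tensorMk m y.1 := fun y m =>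
    LinearMap.lsum_piSingle (S := ℕ) (f := c) (i := y) (x := m)
  refine Module.Finite.of_surjective φ (LinearMap.range_eq_top.1 (Submodule.eq_top_iff'.2 fun z =>
    tensor_induction (zero_mem _) (fun m y => ?_) (fun _ _ => add_mem) z))
  have hy : y ∈ Submodule.span (EndOp M) (s : Set Y) := hs ▸ Submodule.mem_top
  induction hy using Submodule.span_induction generalizing m with
  | mem y hy => exact ⟨_, hφ ⟨y, hy⟩ m⟩
  | zero =>
    have : tensorMk m (0 : Y) = 0 := by
      rw [tensorMk, TensorProduct.tmul_zero]
      rfl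
    rw [this]
    exact zero_mem _
  | add y y' _ _ h h' =>
    rw [tensorMk_add_right]
    exact add_mem (h m) (h' m)
  | smul γ y _ h =>
    rw [tensorMk_smul_right]
    exact h _

end Adjunction

/-! ### Injectivity of evaluation on `add M`. -/

section Static

variable {Λ : Type u} [Ring Λ] {ι : Type} {Q : ι → ModuleCat.{u} Λ} {M : ModuleCat.{u} Λ}

lemma evalMap_naturality {X X' : ModuleCat.{u} Λ} (f : X →ₗ[Λ] X')
    (z : (tensorFunctor M).obj ((homFunctor M).obj X)) :
    evalMap M X' (((tensorFunctor M).map ((homFunctor M).map (ModuleCat.ofHom f))).hom z) =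
      f (evalMap M X z) :=
  LinearMap.congr_fun (congrArg ModuleCat.Hom.hom
    ((tensorHomAdjunction M).counit.naturality (ModuleCat.ofHom f))) z

/-- In `M ⊗_Γ End(M)` one has `m ⊗ h = h(m) ⊗ 1`, so every element is recovered from its evaluation.
-/
lemma evalMap_self_injective : Function.Injective (evalMap M M) := by
  let v : (homFunctor M).obj M := (LinearMap.id : M →ₗ[Λ] M)
  have key : ∀ z, z = tensorMk (evalMap M M z) v := by
    intro z
    induction z using tensor_induction with
    | zero =>
      rw [map_zero]
      symm
      rw [tensorMk, TensorProduct.zero_tmul]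
      rfl
    | mk m h =>
      exact tensorMk_smul_right M m (MulOpposite.op (show M →ₗ[Λ] M from h)) v
    | add x y hx hy =>
      rw [map_add, tensorMk_add_left, ← hx, ← hy]
  intro z z' h
  rw [key z, key z', h]

/-- If the `Q i` are retracts of `M`, the evaluation map is injective on `add {Q i}`. -/
lemma evalMap_injective_of_through (hQ : ∀ i, ∃ (s : Q i →ₗ[Λ] M) (r : M →ₗ[Λ] Q i),
    r ∘ₗ s = LinearMap.id) {X : ModuleCat.{u} Λ} (hX : LinearMap.id ∈ through Q X X) :
    Function.Injective (evalMap M X) := by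
  rw [injective_iff_map_eq_zero]
  intro z hz
  -- Each map through `Q i` also factors through its overmodule `M`, where evaluation is injective;
  -- naturality then shows that it kills `z`. The identity is a sum of such maps.
  have key : ∀ a ∈ through Q X X,
      ((tensorFunctor M).map ((homFunctor M).map (ModuleCat.ofHom a))).hom z = 0 := by
    intro a ha
    refine AddSubgroup.closure_induction ?_ ?_ ?_ ?_ ha
    · rintro _ ⟨i, f, g, rfl⟩
      obtain ⟨s, r, hrs⟩ := hQ i
      have : ModuleCat.ofHom (g ∘ₗ f) = ModuleCat.ofHom (s ∘ₗ f) ≫ ModuleCat.ofHom (g ∘ₗ r) := by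
        refine ModuleCat.hom_ext ?_
        change g ∘ₗ f = g ∘ₗ (r ∘ₗ s) ∘ₗ f
        rw [hrs, LinearMap.id_comp]
      rw [this, Functor.map_comp, Functor.map_comp, ModuleCat.comp_apply]
      have h0 : ((tensorFunctor M).map ((homFunctor M).map (ModuleCat.ofHom (s ∘ₗ f)))).hom z = 0 :=
        evalMap_self_injective (by rw [evalMap_naturality, hz, map_zero, map_zero])
      exact (congrArg _ h0).trans (map_zero _)
    · have : ModuleCat.ofHom (0 : X →ₗ[Λ] X) = 0 := rfl
      rw [this, Functor.map_zero, Functor.map_zero]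
      rfl
    · intro a b _ _ ha hb
      have : ModuleCat.ofHom (a + b) = ModuleCat.ofHom a + ModuleCat.ofHom b := rfl
      rw [this, Functor.map_add, Functor.map_add, ModuleCat.hom_add, LinearMap.add_apply, ha, hb,
        add_zero]
    · intro a _ ha
      have : ModuleCat.ofHom (-a) = -ModuleCat.ofHom a := rfl
      rw [this, Functor.map_neg, Functor.map_neg, ModuleCat.hom_neg, LinearMap.neg_apply, ha,
        neg_zero]
  have h1 : ((tensorFunctor M).map ((homFunctor M).map (𝟙 X))).hom z = 0 := key _ hX
  rwa [CategoryTheory.Functor.map_id, CategoryTheory.Functor.map_id] at h1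

end Static

/-! ### Exactness, fullness and faithfulness of `Hom(M, -)`. -/

section Hom

variable {Λ : Type u} [Ring Λ] {ι : Type} {Q : ι → ModuleCat.{u} Λ} {M : ModuleCat.{u} Λ}

lemma apply_mem_range_evalMap (hQ : ∀ i, ∃ (s : Q i →ₗ[Λ] M) (r : M →ₗ[Λ] Q i),
    r ∘ₗ s = LinearMap.id) {X Y : ModuleCat.{u} Λ} {a : Y →ₗ[Λ] X} (ha : a ∈ through Q Y X)
    (y : Y) : a y ∈ LinearMap.range (evalMap M X) := by
  refine AddSubgroup.closure_induction ?_ ?_ ?_ ?_ ha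
  · rintro _ ⟨i, f, g, rfl⟩
    obtain ⟨s, r, hrs⟩ := hQ i
    refine ⟨tensorMk (Y := (homFunctor M).obj X) (s (f y)) (g ∘ₗ r : M →ₗ[Λ] X), ?_⟩
    exact congrArg g (LinearMap.congr_fun hrs (f y))
  · exact zero_mem _
  · intro a b _ _ ha hb
    exact add_mem ha hb
  · intro a _ ha
    exact neg_mem ha

variable (M) in
/-- The map `Hom(M, X) → Hom(M, Y)` induced by a map `X → Y`. -/
abbrev homMap {X X' : ModuleCat.{u} Λ} (f : X →ₗ[Λ] X') :
    (homFunctor M).obj X →ₗ[EndOp M] (homFunctor M).obj X' :=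
  ((homFunctor M).map (ModuleCat.ofHom f)).hom

lemma homMap_comp {X X' X'' : ModuleCat.{u} Λ} (f : X →ₗ[Λ] X') (g : X' →ₗ[Λ] X'') :
    homMap M (g ∘ₗ f) = homMap M g ∘ₗ homMap M f := rfl

lemma homMap_id (X : ModuleCat.{u} Λ) :
    homMap M (LinearMap.id : X →ₗ[Λ] X) = LinearMap.id := rfl

lemma homMap_injective {X X' : ModuleCat.{u} Λ} {f : X →ₗ[Λ] X'} (hf : Function.Injective f) :
    Function.Injective (homMap M f) := fun a b hab =>
  LinearMap.ext fun m => hf (LinearMap.congr_fun (show f ∘ₗ a = f ∘ₗ b from hab) m)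

lemma homMap_exact {X₁ X₂ X₃ : ModuleCat.{u} Λ} {f : X₁ →ₗ[Λ] X₂} {g : X₂ →ₗ[Λ] X₃}
    (hf : Function.Injective f) (hfg : Function.Exact f g) :
    Function.Exact (homMap M f) (homMap M g) := by
  intro (h : M →ₗ[Λ] X₂)
  constructor
  · intro (hh : g ∘ₗ h = 0)
    have key : ∀ m, ∃ x, f x = h m := fun m => (hfg (h m)).1 (LinearMap.congr_fun hh m)
    choose k hk using key
    exact ⟨({ toFun := k
              map_add' := fun x y => hf (by simp [hk])
              map_smul' := fun r x => hf (by simp [hk]) } : M →ₗ[Λ] X₁), LinearMap.ext hk⟩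
  · rintro ⟨k, rfl⟩
    exact LinearMap.ext fun m => hfg.apply_apply_eq_zero ((show M →ₗ[Λ] X₁ from k) m)

lemma homMap_surjective {X₁ X₂ X₃ : ModuleCat.{u} Λ} {f : X₁ →ₗ[Λ] X₂} {g : X₂ →ₗ[Λ] X₃}
    (hf : Function.Injective f) (hfg : Function.Exact f g) (hg : Function.Surjective g)
    (hM : ExtOneVanishes M X₁) : Function.Surjective (homMap M g) :=
  fun h => hM.exists_lift hf hfg hg h

lemma homMap_mem_through {X Y : ModuleCat.{u} Λ} {a : X →ₗ[Λ] Y} (ha : a ∈ through Q X Y) :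
    homMap M a ∈ through (fun i => (homFunctor M).obj (Q i)) ((homFunctor M).obj X)
      ((homFunctor M).obj Y) := by
  refine AddSubgroup.closure_induction ?_ ?_ ?_ ?_ ha
  · rintro _ ⟨i, f, g, rfl⟩
    exact comp_mem_through_of_factor (M := fun i => (homFunctor M).obj (Q i)) (i := i)
      (homMap M f) (homMap M g)
  · exact zero_mem _
  · intro a b _ _ ha hb
    exact add_mem ha hb
  · intro a _ ha
    have : homMap M (-a) = -homMap M a := LinearMap.ext fun h => LinearMap.neg_comp _ _
    rw [this]
    exact neg_mem ha

variable (M) in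
/-- `Hom(M, M)` is the regular module. -/
def regularEquiv : EndOp M ≃ₗ[EndOp M] (homFunctor M).obj M where
  toFun γ := γ.unop
  invFun h := MulOpposite.op (show M →ₗ[Λ] M from h)
  map_add' _ _ := rfl
  map_smul' _ _ := rfl
  left_inv _ := rfl
  right_inv _ := rfl

variable (M Q) in
/-- `Hom(M, ⨁ Q(i))` is the direct sum of the `Hom(M, Q(i))`. -/
def homPiEquiv [Finite ι] :
    (homFunctor M).obj (finSum Q) ≃ₗ[EndOp M] ∀ i, (homFunctor M).obj (Q i) where
  toFun h i := (LinearMap.proj i ∘ₗ (show M →ₗ[Λ] ∀ i, Q i from h) : M →ₗ[Λ] Q i)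
  invFun f := (LinearMap.pi fun i => (show M →ₗ[Λ] Q i from f i) : M →ₗ[Λ] ∀ i, Q i)
  map_add' _ _ := rfl
  map_smul' _ _ := rfl
  left_inv _ := rfl
  right_inv _ := rfl

lemma exists_retract_finSum [Finite ι] (i : ι) :
    ∃ (s : Q i →ₗ[Λ] finSum Q) (r : finSum Q →ₗ[Λ] Q i), r ∘ₗ s = LinearMap.id := by
  classical
  refine ⟨LinearMap.single Λ (fun i => Q i) i, LinearMap.proj i, LinearMap.ext fun x => ?_⟩
  exact Pi.single_eq_same (M := fun i => Q i) i x

lemma projective_homFunctor_obj [Finite ι] (i : ι) :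
    Module.Projective (EndOp (finSum Q)) ((homFunctor (finSum Q)).obj (Q i)) := by
  obtain ⟨s, r, hrs⟩ := exists_retract_finSum (Q := Q) i
  have := Module.Projective.of_equiv (regularEquiv (finSum Q))
  refine Module.Projective.of_split (homMap (finSum Q) s) (homMap (finSum Q) r) ?_
  rw [← homMap_comp, hrs, homMap_id]

lemma finite_homFunctor_obj [Finite ι] (i : ι) :
    Module.Finite (EndOp (finSum Q)) ((homFunctor (finSum Q)).obj (Q i)) := by
  obtain ⟨s, r, hrs⟩ := exists_retract_finSum (Q := Q) i
  have hr : Function.Surjective (homMap (finSum Q) r) := fun x => ⟨homMap (finSum Q) s x, by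
    rw [← LinearMap.comp_apply, ← homMap_comp, hrs, homMap_id, LinearMap.id_apply]⟩
  exact Module.Finite.of_surjective
    (homMap (finSum Q) r ∘ₗ (regularEquiv (finSum Q)).toLinearMap)
    (hr.comp (regularEquiv (finSum Q)).surjective)

/-- `Hom(M, -)` is full on maps out of modules `X` for which evaluation is bijective. -/
lemma exists_homMap_eq {X X' : ModuleCat.{u} Λ} (hX : Function.Bijective (evalMap M X))
    (φ : (homFunctor M).obj X →ₗ[EndOp M] (homFunctor M).obj X') :
    ∃ ψ : X →ₗ[Λ] X', homMap M ψ = φ := by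
  let e := LinearEquiv.ofBijective (evalMap M X) hX
  -- The preimage of `φ` is `GF(X) → GF(X')` conjugated by evaluation; on `h m`, which is the
  -- evaluation of `m ⊗ h`, it gives `φ(h)(m)`.
  refine ⟨evalMap M X' ∘ₗ ((tensorFunctor M).map (ModuleCat.ofHom φ)).hom ∘ₗ e.symm.toLinearMap,
    LinearMap.ext fun h => LinearMap.ext fun m => ?_⟩
  have h1 : e.symm ((show M →ₗ[Λ] X from h) m) = tensorMk m h := by
    rw [LinearEquiv.symm_apply_eq]
    rfl
  change evalMap M X' (((tensorFunctor M).map (ModuleCat.ofHom φ)).hom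
    (e.symm ((show M →ₗ[Λ] X from h) m))) = _
  rw [h1]
  rfl

/-- `Hom(M, -)` is faithful on maps out of modules `X` for which evaluation is surjective. -/
lemma eq_of_homMap_eq {X X' : ModuleCat.{u} Λ} (hX : Function.Surjective (evalMap M X))
    {f g : X →ₗ[Λ] X'} (h : homMap M f = homMap M g) : f = g := by
  ext x
  obtain ⟨z, rfl⟩ := hX x
  rw [← evalMap_naturality, ← evalMap_naturality]
  have : (homFunctor M).map (ModuleCat.ofHom f) = (homFunctor M).map (ModuleCat.ofHom g) :=
    ModuleCat.hom_ext h
  rw [this]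

end Hom

/-! ### `F` on `𝓕(Θ)`: evaluation, standard modules, density. -/

namespace IsExtProjectiveStratifyingSystem

variable {A : Type u} [Ring A] {ι : Type} [Finite ι] [LinearOrder ι] {Θ Q : ι → ModuleCat.{u} A}

lemma evalMap_surjective (h : IsExtProjectiveStratifyingSystem Θ Q)
    {X : ModuleCat.{u} A} (hX : Filtered Θ X) :
    Function.Surjective (evalMap (finSum Q) X) := by
  intro x
  obtain ⟨Z, Y, f, g, hf, hfg, hg, hZ, hY⟩ := h.exists_cover_of_filtered hX
  obtain ⟨y, rfl⟩ := hg x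
  exact apply_mem_range_evalMap exists_retract_finSum (comp_mem_through_left hY g) y

lemma homMap_surjective_of_filtered (h : IsExtProjectiveStratifyingSystem Θ Q)
    {X₁ X₂ X₃ : ModuleCat.{u} A} {f : X₁ →ₗ[A] X₂}
    {g : X₂ →ₗ[A] X₃} (hf : Function.Injective f) (hfg : Function.Exact f g)
    (hg : Function.Surjective g) (h₁ : Filtered Θ X₁) :
    Function.Surjective (homMap (finSum Q) g) :=
  homMap_surjective hf hfg hg (h.ext_finSum_of_filtered h₁)

/-- Injectivity is a four-lemma chase along a cover `Z → Y → X`: evaluation is onto at `Z` and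
injective at `Y`, and `GF(Y) → GF(X)` is onto because `Ext¹(Q, Z) = 0`. -/
lemma evalMap_bijective (h : IsExtProjectiveStratifyingSystem Θ Q)
    {X : ModuleCat.{u} A} (hX : Filtered Θ X) :
    Function.Bijective (evalMap (finSum Q) X) := by
  refine ⟨?_, h.evalMap_surjective hX⟩
  obtain ⟨Z, Y, f, g, hf, hfg, hg, hZ, hY⟩ := h.exists_cover_of_filtered hX
  let GF {X X' : ModuleCat.{u} A} (f : X →ₗ[A] X') :=
    ((tensorFunctor (finSum Q)).map ((homFunctor (finSum Q)).map (ModuleCat.ofHom f))).hom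
  have hGF : ∀ z, ∃ z', GF g z' = z := by
    intro z
    induction z using tensor_induction with
    | zero => exact ⟨0, map_zero _⟩
    | mk m k =>
      obtain ⟨k', rfl⟩ := h.homMap_surjective_of_filtered hf hfg hg hZ k
      exact ⟨tensorMk m k', rfl⟩
    | add x y hx hy =>
      obtain ⟨x', rfl⟩ := hx
      obtain ⟨y', rfl⟩ := hy
      exact ⟨x' + y', map_add _ _ _⟩
  rw [injective_iff_map_eq_zero]
  intro z hz
  obtain ⟨z', rfl⟩ := hGF z
  rw [evalMap_naturality] at hz
  obtain ⟨x, hx⟩ := (hfg _).1 hz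
  obtain ⟨w, rfl⟩ := h.evalMap_surjective hZ x
  rw [← evalMap_naturality] at hx
  have h1 := evalMap_injective_of_through exists_retract_finSum hY hx
  rw [← h1]
  have h2 : GF g ∘ₗ GF f = 0 := by
    have : ModuleCat.ofHom f ≫ ModuleCat.ofHom g = 0 :=
      ModuleCat.hom_ext hfg.linearMap_comp_eq_zero
    have h3 := congrArg (fun a => ((tensorFunctor (finSum Q)).map
      ((homFunctor (finSum Q)).map a)).hom) this
    simp only [Functor.map_comp, Functor.map_zero] at h3
    exact h3
  exact LinearMap.congr_fun h2 w

lemma homMap_shortExact (h : IsExtProjectiveStratifyingSystem Θ Q)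
    (S : ShortComplex (ModuleCat.{u} A)) (h₁ : Filtered Θ S.X₁)
    (hS : S.ShortExact) : (S.map (homFunctor (finSum Q))).ShortExact := by
  have hf := hS.moduleCat_injective_f
  have hg := hS.moduleCat_surjective_g
  have hfg := (ShortComplex.ShortExact.moduleCat_exact_iff_function_exact S).1 hS.exact
  exact shortExact_of_exact (homMap_injective hf) (homMap_exact hf hfg)
    (h.homMap_surjective_of_filtered hf hfg hg h₁)

/-- For `j > i`, maps `F(Q(j)) → F(Θ(i))` come from maps `Q(j) → Θ(i)` and vanish, so the trace lies
in the image of `F(K)`. Conversely `K` is covered by a module in `add {Q(j) : j > i}`, and elements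
of `F(K)` lift to `F` of that cover. -/
lemma trace_eq_range_homMap (h : IsExtProjectiveStratifyingSystem Θ Q)
    {i : ι} {K : ModuleCat.{u} A} {α : K →ₗ[A] Q i} {β : Q i →ₗ[A] Θ i}
    (hα : Function.Injective α) (hαβ : Function.Exact α β)
    (hK : FilteredBy Θ (fun j => i < j) K) :
    trace (finSum fun j : {j : ι // i < j} => (homFunctor (finSum Q)).obj (Q j))
      ((homFunctor (finSum Q)).obj (Q i)) = LinearMap.range (homMap (finSum Q) α) := by
  classical
  have := Fintype.ofFinite {j : ι // i < j}
  refine le_antisymm (iSup_le fun φ => ?_) ?_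
  · rintro _ ⟨x, rfl⟩
    suffices h0 : homMap (finSum Q) β ∘ₗ φ = 0 from
      ((homMap_exact hα hαβ) _).1 (LinearMap.congr_fun h0 x)
    let φ' : (∀ j : {j : ι // i < j}, (homFunctor (finSum Q)).obj (Q j)) →ₗ[EndOp (finSum Q)]
      (homFunctor (finSum Q)).obj (Θ i) := homMap (finSum Q) β ∘ₗ φ
    change φ' = 0
    refine LinearMap.pi_ext' fun j => ?_
    obtain ⟨ψ, hψ⟩ := exists_homMap_eq (h.evalMap_bijective (h.filtered_Q j.1))
      (φ' ∘ₗ LinearMap.single (EndOp (finSum Q))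
        (fun j : {j : ι // i < j} => (homFunctor (finSum Q)).obj (Q j)) j)
    rw [← hψ, h.hom_Q_theta_eq_zero j.2 ψ]
    rfl
  · rintro _ ⟨k, rfl⟩
    obtain ⟨Z, Y, f, g, hf, hfg, hg, hZ, hY⟩ :=
      h.exists_cover (p := fun j => i < j) (fun a b hab ha => ha.trans_le hab) hK
    obtain ⟨k', rfl⟩ := h.homMap_surjective_of_filtered hf hfg hg
      (hZ.mono fun _ _ => trivial) k
    have key : ∀ a ∈ through (fun j : {j // i < j} => Q j) Y (Q i),
        homMap (finSum Q) a k' ∈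
        trace (finSum fun j : {j : ι // i < j} => (homFunctor (finSum Q)).obj (Q j))
          ((homFunctor (finSum Q)).obj (Q i)) := by
      intro a ha
      refine AddSubgroup.closure_induction ?_ ?_ ?_ ?_ ha
      · rintro _ ⟨j, b, c, rfl⟩
        refine Submodule.mem_iSup_of_mem (homMap (finSum Q) c ∘ₗ
          (LinearMap.proj j : (∀ j : {j : ι // i < j}, (homFunctor (finSum Q)).obj (Q j))
            →ₗ[EndOp (finSum Q)] _)) ?_
        refine ⟨(Pi.single (M := fun j : {j : ι // i < j} => (homFunctor (finSum Q)).obj (Q j))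
          j (homMap (finSum Q) b k') :), ?_⟩
        exact congrArg (homMap (finSum Q) c)
          (Pi.single_eq_same (M := fun j : {j : ι // i < j} => (homFunctor (finSum Q)).obj (Q j))
            j (homMap (finSum Q) b k'))
      · exact zero_mem _
      · intro a b _ _ ha hb
        exact add_mem ha hb
      · intro a _ ha
        have : homMap (finSum Q) (-a) k' = -homMap (finSum Q) a k' := LinearMap.neg_comp _ _
        rw [this]
        exact neg_mem ha
    exact key (α ∘ₗ g) (by simpa using comp_mem_through_left hY (α ∘ₗ g))

/-- `F(Θ(i)) ≃ Δ(i)`. -/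
lemma nonempty_equiv_standardModule (h : IsExtProjectiveStratifyingSystem Θ Q)
    (i : ι) : Nonempty ((homFunctor (finSum Q)).obj (Θ i)
    ≃ₗ[EndOp (finSum Q)] standardModule (fun j => (homFunctor (finSum Q)).obj (Q j)) i) := by
  obtain ⟨K, α, β, hα, hαβ, hβ, hK⟩ := h.exists_sequence i
  refine ⟨((Submodule.quotEquivOfEq _ _ ?_).trans ((homMap (finSum Q) β).quotKerEquivOfSurjective
    (h.homMap_surjective_of_filtered hα hαβ hβ (hK.mono fun _ _ => trivial)))).symm⟩
  rw [h.trace_eq_range_homMap hα hαβ hK]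
  exact ((homMap_exact hα hαβ).linearMap_ker_eq).symm

lemma filtered_homFunctor_obj (h : IsExtProjectiveStratifyingSystem Θ Q)
    {X : ModuleCat.{u} A} (hX : Filtered Θ X) :
    Filtered (standardModule fun j => (homFunctor (finSum Q)).obj (Q j))
      ((homFunctor (finSum Q)).obj X) := by
  refine FilteredBy.induction (motive := fun X => Filtered (standardModule fun j =>
    (homFunctor (finSum Q)).obj (Q j)) ((homFunctor (finSum Q)).obj X)) ?_ ?_ hX
  · intro X _
    have : Subsingleton ((homFunctor (finSum Q)).obj X) :=
      inferInstanceAs (Subsingleton (finSum Q →ₗ[A] X))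
    exact .of_subsingleton _
  · intro X' X i f g _ hf hfg hg hX' hFX'
    obtain ⟨e⟩ := h.nonempty_equiv_standardModule i
    refine FilteredBy.of_exact (homMap_injective hf) (homMap_exact hf hfg)
      (h.homMap_surjective_of_filtered hf hfg hg hX') hFX' ?_
    exact (FilteredBy.single (p := fun _ => True) (i := i) trivial).of_equiv e.symm

/-- The functor `F` is dense: every module in `𝓕(Δ)` comes from `𝓕(Θ)`. -/
lemma exists_equiv_homFunctor_obj (h : IsExtProjectiveStratifyingSystem Θ Q)
    {Y : ModuleCat.{u} (EndOp (finSum Q))}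
    (hY : Filtered (standardModule fun j => (homFunctor (finSum Q)).obj (Q j)) Y) :
    ∃ X : ModuleCat.{u} A, Filtered Θ X ∧
      Nonempty (Y ≃ₗ[EndOp (finSum Q)] (homFunctor (finSum Q)).obj X) := by
  refine FilteredBy.induction (motive := fun Y => ∃ X : ModuleCat.{u} A, Filtered Θ X ∧
      Nonempty (Y ≃ₗ[EndOp (finSum Q)] (homFunctor (finSum Q)).obj X)) ?_ ?_ hY
  · intro Y _
    have : Subsingleton ((homFunctor (finSum Q)).obj (ModuleCat.of A PUnit)) :=
      inferInstanceAs (Subsingleton (finSum Q →ₗ[A] PUnit.{u + 1}))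
    exact ⟨ModuleCat.of A PUnit, .of_subsingleton _, ⟨0⟩⟩
  · rintro Y' Y i a b - ha hab hb - ⟨X', hX', ⟨e'⟩⟩
    obtain ⟨K, α, β, hα, hαβ, hβ, hK⟩ := h.exists_sequence i
    have hK' : Filtered Θ K := hK.mono fun _ _ => trivial
    obtain ⟨eΔ⟩ := h.nonempty_equiv_standardModule i
    have := projective_homFunctor_obj (Q := Q) i
    -- Projectivity of `F(Q i)` lifts `F(Q i) → Δ(i)` to `l` with values in `Y`. On `F(K)` the lift
    -- lands in `Y' ≃ F(X')`, and by fullness this restriction is `F(φ)` for some `φ : K → X'`.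
    obtain ⟨l, hl⟩ := Module.projective_lifting_property b
      (eΔ.toLinearMap ∘ₗ homMap (finSum Q) β) hb
    have hl' : ∀ q, b (l q) = eΔ (homMap (finSum Q) β q) := fun q => LinearMap.congr_fun hl q
    have hμ : ∀ k, ∃ y, a y = l (homMap (finSum Q) α k) := fun k => (hab _).1 (by
      rw [hl', (homMap_exact hα hαβ).apply_apply_eq_zero, map_zero])
    choose μ hμ using hμ
    let μ' : (homFunctor (finSum Q)).obj K →ₗ[EndOp (finSum Q)] Y' :=
      { toFun := μ
        map_add' := fun x y => ha (by rw [map_add, hμ, hμ, hμ, map_add, map_add])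
        map_smul' := fun r x => ha (by
          rw [RingHom.id_apply, map_smul, hμ, hμ, map_smul, map_smul]) }
    obtain ⟨φ, hφ⟩ := exists_homMap_eq (h.evalMap_bijective hK') (e'.toLinearMap ∘ₗ μ')
    have hφ' : ∀ k, homMap (finSum Q) φ k = e' (μ k) := fun k => LinearMap.congr_fun hφ k
    let E : ModuleCat.{u} A := ModuleCat.of A (X' × Q i)
    -- The cokernel of `δ` is the pushout of `φ` and `α`, an extension of `Θ i` by `X'`. The sign
    -- identifies `φ k` with `α k`.
    let δ : K →ₗ[A] E := (-φ).prod α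
    have hδ : ∀ k, δ k = (-φ k, α k) := fun _ => rfl
    have hδi : Function.Injective δ := fun x y hxy => hα (congrArg Prod.snd hxy)
    let X : ModuleCat.{u} A := ModuleCat.of A (E ⧸ LinearMap.range δ)
    let π : E →ₗ[A] X := (LinearMap.range δ).mkQ
    have hπ : Function.Surjective π := Submodule.mkQ_surjective _
    have hδπ : Function.Exact δ π := LinearMap.exact_map_mkQ_range δ
    have hker : LinearMap.range δ ≤ LinearMap.ker (β ∘ₗ LinearMap.snd A X' (Q i)) := by
      rintro _ ⟨k, rfl⟩
      exact hαβ.apply_apply_eq_zero k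
    let c : X →ₗ[A] Θ i := (LinearMap.range δ).liftQ _ hker
    have hc : ∀ x q, c (π (x, q)) = β q := fun _ _ => rfl
    have hX : Filtered Θ X := by
      refine hX'.extend (i := i) trivial (f := π ∘ₗ LinearMap.inl A X' (Q i)) (g := c) ?_ ?_ ?_
      · rw [injective_iff_map_eq_zero]
        intro x hx
        obtain ⟨k, hk⟩ := (hδπ _).1 hx
        have h2 : α k = 0 := congrArg Prod.snd hk
        rw [map_eq_zero_iff α hα] at h2
        have h1 : -φ k = x := congrArg Prod.fst hk
        rw [← h1, h2, map_zero, neg_zero]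
      · intro y
        obtain ⟨⟨x, q⟩, rfl⟩ := hπ y
        rw [hc]
        constructor
        · intro hq
          obtain ⟨k, rfl⟩ := (hαβ q).1 hq
          refine ⟨x + φ k, ?_⟩
          have : (LinearMap.inl A X' (Q i) (x + φ k) : E) = (x, α k) - δ k := by
            rw [hδ]
            exact Prod.ext (sub_neg_eq_add x (φ k)).symm (sub_self (α k)).symm
          rw [LinearMap.comp_apply, this, map_sub, hδπ.apply_apply_eq_zero, sub_zero]
        · rintro ⟨z, hz⟩
          have := congrArg c hz
          rw [hc] at this
          rw [← this]
          exact map_zero β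
      · intro t
        obtain ⟨q, rfl⟩ := hβ t
        exact ⟨π (0, q), rfl⟩
    -- Both `ρ` and `F(π)` are onto with kernel `F(δ)(F(K))`, so their targets `Y` and `F(X)` are
    -- isomorphic.
    let ρ : (homFunctor (finSum Q)).obj E →ₗ[EndOp (finSum Q)] Y :=
      a ∘ₗ e'.symm.toLinearMap ∘ₗ homMap (finSum Q) (LinearMap.fst A X' (Q i) : E →ₗ[A] X') +
        l ∘ₗ homMap (finSum Q) (LinearMap.snd A X' (Q i) : E →ₗ[A] Q i)
    have hρ : ∀ w, ρ w = a (e'.symm (homMap (finSum Q) (LinearMap.fst A X' (Q i) : E →ₗ[A] X') w)) +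
      l (homMap (finSum Q) (LinearMap.snd A X' (Q i) : E →ₗ[A] Q i) w) := fun _ => rfl
    have hpair : ∀ (x : (homFunctor (finSum Q)).obj X') (q : (homFunctor (finSum Q)).obj (Q i)),
        ∃ w : (homFunctor (finSum Q)).obj E,
        homMap (finSum Q) (LinearMap.fst A X' (Q i) : E →ₗ[A] X') w = x ∧
        homMap (finSum Q) (LinearMap.snd A X' (Q i) : E →ₗ[A] Q i) w = q := fun x q =>
      ⟨(LinearMap.prod (show finSum Q →ₗ[A] X' from x) (show finSum Q →ₗ[A] Q i from q) :
        finSum Q →ₗ[A] X' × Q i), rfl, rfl⟩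
    have hρs : Function.Surjective ρ := by
      intro y
      obtain ⟨q, hq⟩ := h.homMap_surjective_of_filtered hα hαβ hβ hK' (eΔ.symm (b y))
      obtain ⟨y', hy'⟩ := (hab (y - l q)).1 (by
        rw [map_sub, hl', hq, LinearEquiv.apply_symm_apply, sub_self])
      obtain ⟨w, hw1, hw2⟩ := hpair (e' y') q
      refine ⟨w, ?_⟩
      rw [hρ, hw1, hw2, LinearEquiv.symm_apply_apply, hy']
      abel
    have hfst : ∀ k, homMap (finSum Q) (LinearMap.fst A X' (Q i) : E →ₗ[A] X')
        (homMap (finSum Q) δ k) = -(e' (μ k)) := fun k => by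
      rw [← hφ']
      exact LinearMap.neg_comp (show finSum Q →ₗ[A] K from k) φ
    have hsnd : ∀ k, homMap (finSum Q) (LinearMap.snd A X' (Q i) : E →ₗ[A] Q i)
        (homMap (finSum Q) δ k) = homMap (finSum Q) α k := fun k => rfl
    have hkerρ : LinearMap.ker ρ = LinearMap.ker (homMap (finSum Q) π) := by
      rw [(homMap_exact hδi hδπ).linearMap_ker_eq]
      ext w
      rw [LinearMap.mem_ker]
      constructor
      · intro hw
        rw [hρ] at hw
        have h1 := congrArg b hw
        rw [map_add, hab.apply_apply_eq_zero, zero_add, hl', map_zero,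
          LinearEquiv.map_eq_zero_iff] at h1
        obtain ⟨k, hk⟩ := ((homMap_exact hα hαβ) _).1 h1
        refine ⟨k, ?_⟩
        rw [← hk, ← hμ, ← map_add, map_eq_zero_iff a ha, ← eq_neg_iff_add_eq_zero,
          LinearEquiv.symm_apply_eq, map_neg, ← hfst] at hw
        rw [← hsnd] at hk
        refine LinearMap.ext fun t => Prod.ext ?_ ?_
        · exact LinearMap.congr_fun hw.symm t
        · exact LinearMap.congr_fun hk t
      · rintro ⟨k, rfl⟩
        rw [hρ, hfst, hsnd, ← hμ, map_neg, LinearEquiv.symm_apply_apply, map_neg,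
          neg_add_cancel]
    exact ⟨X, hX, ⟨(ρ.quotKerEquivOfSurjective hρs).symm.trans
      ((Submodule.quotEquivOfEq _ _ hkerρ).trans
        ((homMap (finSum Q) π).quotKerEquivOfSurjective
          (h.homMap_surjective_of_filtered hδi hδπ hπ hK')))⟩⟩

end IsExtProjectiveStratifyingSystem

/-! ### Finiteness over the artinian base ring. -/

section ArtinAlgebra

lemma isArtinianRing_of_finite_algebra (R : Type w) [CommRing R] [IsArtinianRing R]
    {Λ : Type u} [Ring Λ]
    [Algebra R Λ] [Module.Finite R Λ] : IsArtinianRing Λ := IsArtinianRing.of_finite R Λ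

/-- Values on generators embed `Hom(X, Y)` in a finite power of `Y`, which is noetherian over `R`.
-/
lemma finite_hom_of_finite (R : Type w) [CommRing R] [IsArtinianRing R] {Λ : Type u} [Ring Λ]
    [Algebra R Λ] [Module.Finite R Λ]
    {X Y : Type u} [AddCommGroup X] [AddCommGroup Y] [Module Λ X]
    [Module Λ Y] [Module R Y] [IsScalarTower R Λ Y] [hX : Module.Finite Λ X] [Module.Finite Λ Y] :
    Module.Finite R (X →ₗ[Λ] Y) := by
  obtain ⟨s, hs⟩ := hX.fg_top
  have : Module.Finite R Y := Module.Finite.trans Λ Y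
  let φ : (X →ₗ[Λ] Y) →ₗ[R] (s → Y) :=
    { toFun := fun f x => f x
      map_add' := fun _ _ => rfl
      map_smul' := fun _ _ => rfl }
  refine Module.Finite.of_injective φ fun f g hfg => ?_
  exact LinearMap.ext_on hs fun x hx => congrFun hfg ⟨x, hx⟩

lemma finite_endOp (R : Type w) [CommRing R] [IsArtinianRing R] {Λ : Type u} [Ring Λ]
    [Algebra R Λ] [Module.Finite R Λ] (M : ModuleCat.{u} Λ) [Module.Finite Λ M] :
    @Module.Finite R (EndOp M) _ _ (endOpAlgebra M R).toModule := by
  let : Module R M := Module.restrictScalars R Λ M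
  have : IsScalarTower R Λ M := IsScalarTower.restrictScalars R Λ M
  have : Module.Finite R (Module.End Λ M) := finite_hom_of_finite R
  exact Module.Finite.equiv (MulOpposite.opLinearEquiv R : Module.End Λ M ≃ₗ[R] EndOp M)

lemma finite_homFunctor_obj_of_finite (R : Type w) [CommRing R] [IsArtinianRing R]
    {Λ : Type u} [Ring Λ]
    [Algebra R Λ] [Module.Finite R Λ] (M : ModuleCat.{u} Λ) [Module.Finite Λ M]
    (X : ModuleCat.{u} Λ)
    [Module.Finite Λ X] : Module.Finite (EndOp M) ((homFunctor M).obj X) := by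
  let : Module R M := Module.restrictScalars R Λ M
  have : IsScalarTower R Λ M := IsScalarTower.restrictScalars R Λ M
  let : Module R X := Module.restrictScalars R Λ X
  have : IsScalarTower R Λ X := IsScalarTower.restrictScalars R Λ X
  have : Module.Finite R (M →ₗ[Λ] X) := finite_hom_of_finite R
  have : IsScalarTower R (EndOp M) (M →ₗ[Λ] X) := by
    refine ⟨fun r γ h => LinearMap.ext fun m => ?_⟩
    change h (r • γ.unop m) = r • h (γ.unop m)
    exact h.map_smul_of_tower r _
  exact (Module.Finite.of_restrictScalars_finite R (EndOp M) (M →ₗ[Λ] X) :)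

lemma isArtinianRing_endOp (R : Type w) [CommRing R] [IsArtinianRing R] {Λ : Type u} [Ring Λ]
    [Algebra R Λ] [Module.Finite R Λ] (M : ModuleCat.{u} Λ) [Module.Finite Λ M] :
    IsArtinianRing (EndOp M) := by
  let := endOpAlgebra M R
  have := finite_endOp R M
  exact IsArtinianRing.of_finite R (EndOp M)

end ArtinAlgebra

/-- `X` is a retract of some `Γ^n`, and `Γ ≃ F(⨁ Q(i))` is in `add` of the `F(Q(i))`. -/
lemma id_mem_through_of_projective {ι : Type} [Finite ι] {A : Type u} [Ring A]
    {Q : ι → ModuleCat.{u} A} (X : ModuleCat.{u} (EndOp (finSum Q)))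
    [Module.Finite (EndOp (finSum Q)) X] [Module.Projective (EndOp (finSum Q)) X] :
    LinearMap.id ∈ through (fun i => (homFunctor (finSum Q)).obj (Q i)) X X := by
  obtain ⟨n, f, hf⟩ := Module.Finite.exists_fin' (EndOp (finSum Q)) X
  obtain ⟨s, hs⟩ := Module.projective_lifting_property f LinearMap.id hf
  have h1 := homMap_mem_through (M := finSum Q) (id_mem_through_pi (M := Q))
  rw [homMap_id] at h1
  have h2 := id_mem_through_of_retract (X := ModuleCat.of (EndOp (finSum Q)) (EndOp (finSum Q)))
    (regularEquiv (finSum Q)).toLinearMap (regularEquiv (finSum Q)).symm.toLinearMap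
    (LinearEquiv.symm_comp _) h1
  have h3 := through_mono (M := fun _ : Fin n =>
    ModuleCat.of (EndOp (finSum Q)) (EndOp (finSum Q))) (fun _ => h2) _ _ id_mem_through_pi
  exact id_mem_through_of_retract s f hs h3

/-! ### The equivalence, the indecomposable projectives, and stratification. -/

namespace IsExtProjectiveStratifyingSystem

variable {A : Type u} [Ring A] {ι : Type} [Finite ι] [LinearOrder ι] {Θ Q : ι → ModuleCat.{u} A}

lemma finite_finSum (h : IsExtProjectiveStratifyingSystem Θ Q) : Module.Finite A (finSum Q) := by
  have := h.finite_Q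
  exact inferInstanceAs (Module.Finite A (∀ i, Q i))

lemma isIso_counit_app (h : IsExtProjectiveStratifyingSystem Θ Q)
    {X : ModuleCat.{u} A} (hX : Filtered Θ X) :
    IsIso ((tensorHomAdjunction (finSum Q)).counit.app X) :=
  (ConcreteCategory.isIso_iff_bijective _).2 (h.evalMap_bijective hX)

/-- On `F(X)` the unit is a one-sided inverse of `F` of the counit, which is an isomorphism; density
and naturality carry this over to `Y`. -/
lemma isIso_unit_app (h : IsExtProjectiveStratifyingSystem Θ Q)
    {Y : ModuleCat.{u} (EndOp (finSum Q))}
    (hY : Filtered (standardModule fun j => (homFunctor (finSum Q)).obj (Q j)) Y) :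
    IsIso ((tensorHomAdjunction (finSum Q)).unit.app Y) := by
  obtain ⟨X, hX, ⟨e⟩⟩ := h.exists_equiv_homFunctor_obj hY
  have := h.isIso_counit_app hX
  have h1 := (tensorHomAdjunction (finSum Q)).right_triangle_components X
  have : IsIso ((tensorHomAdjunction (finSum Q)).unit.app ((homFunctor (finSum Q)).obj X)) :=
    IsIso.of_isIso_fac_right h1
  exact (NatTrans.isIso_app_iff_of_iso _ e.toModuleIso).2 this

lemma filtered_tensorFunctor_obj (h : IsExtProjectiveStratifyingSystem Θ Q)
    {Y : ModuleCat.{u} (EndOp (finSum Q))}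
    (hY : Filtered (standardModule fun j => (homFunctor (finSum Q)).obj (Q j)) Y) :
    Filtered Θ ((tensorFunctor (finSum Q)).obj Y) := by
  obtain ⟨X, hX, ⟨e⟩⟩ := h.exists_equiv_homFunctor_obj hY
  exact (hX.of_equiv (LinearEquiv.ofBijective _ (h.evalMap_bijective hX)).symm).of_equiv
    ((tensorFunctor (finSum Q)).mapIso e.symm.toModuleIso).toLinearEquiv

/-- `F` and `G` restrict to quasi-inverse equivalences between `𝓕(Θ)` and `𝓕(Δ)`. -/
lemma exists_equivalence (h : IsExtProjectiveStratifyingSystem Θ Q) :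
    ∃ (hF : ∀ X : (Filtered Θ).FullSubcategory,
        Filtered (standardModule fun j => (homFunctor (finSum Q)).obj (Q j))
          ((homFunctor (finSum Q)).obj X.obj))
      (hG : ∀ Y : (Filtered (standardModule fun j =>
          (homFunctor (finSum Q)).obj (Q j))).FullSubcategory,
        Filtered Θ ((tensorFunctor (finSum Q)).obj Y.obj))
      (e : (Filtered Θ).FullSubcategory ≌
        (Filtered (standardModule fun j => (homFunctor (finSum Q)).obj (Q j))).FullSubcategory),
      e.functor = (Filtered _).lift ((Filtered Θ).ι ⋙ homFunctor (finSum Q)) hF ∧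
      e.inverse = (Filtered Θ).lift ((Filtered _).ι ⋙ tensorFunctor (finSum Q)) hG := by
  refine ⟨fun X => h.filtered_homFunctor_obj X.property,
    fun Y => h.filtered_tensorFunctor_obj Y.property, ?_⟩
  let Δ := standardModule fun j => (homFunctor (finSum Q)).obj (Q j)
  let F' := (Filtered Δ).lift ((Filtered Θ).ι ⋙ homFunctor (finSum Q))
    (fun X => h.filtered_homFunctor_obj X.property)
  let G' := (Filtered Θ).lift ((Filtered Δ).ι ⋙ tensorFunctor (finSum Q))
    (fun Y => h.filtered_tensorFunctor_obj Y.property)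
  let adj : G' ⊣ F' := Adjunction.mkOfUnitCounit
    { unit :=
        { app := fun Y => ObjectProperty.homMk ((tensorHomAdjunction (finSum Q)).unit.app Y.obj)
          naturality := fun _ _ f => ObjectProperty.hom_ext _
            ((tensorHomAdjunction (finSum Q)).unit.naturality f.hom) }
      counit :=
        { app := fun X => ObjectProperty.homMk ((tensorHomAdjunction (finSum Q)).counit.app X.obj)
          naturality := fun _ _ f => ObjectProperty.hom_ext _
            ((tensorHomAdjunction (finSum Q)).counit.naturality f.hom) }
      left_triangle := by
        ext Y : 2
        refine ObjectProperty.hom_ext _ ?_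
        exact congrArg (𝟙 _ ≫ ·)
          ((tensorHomAdjunction (finSum Q)).left_triangle_components Y.obj)
      right_triangle := by
        ext X : 2
        refine ObjectProperty.hom_ext _ ?_
        exact congrArg (𝟙 _ ≫ ·)
          ((tensorHomAdjunction (finSum Q)).right_triangle_components X.obj) }
  have hu : ∀ Y, IsIso (adj.unit.app Y) := fun Y => by
    rw [← ObjectProperty.isIso_hom_iff]
    exact h.isIso_unit_app Y.property
  have hc : ∀ X, IsIso (adj.counit.app X) := fun X => by
    rw [← ObjectProperty.isIso_hom_iff]
    exact h.isIso_counit_app X.property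
  -- The left adjoint is `G'`, so the equivalence of the adjunction starts at `𝓕(Δ)` and has to be
  -- reversed.
  exact ⟨(adj.toEquivalence).symm, rfl, rfl⟩

/-- By full faithfulness, idempotents of `End F(Q i)` come from idempotents of `End Q i`, which are
trivial. -/
lemma indecomposable_homFunctor_obj (h : IsExtProjectiveStratifyingSystem Θ Q) (i : ι) :
    Indecomposable ((homFunctor (finSum Q)).obj (Q i)) := by
  have hev := h.evalMap_bijective (h.filtered_Q i)
  have : Nontrivial ((homFunctor (finSum Q)).obj (Q i)) := by
    by_contra hn
    rw [not_nontrivial_iff_subsingleton] at hn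
    have h1 : (LinearMap.id : Q i →ₗ[A] Q i) = 0 :=
      eq_of_homMap_eq hev.2 (LinearMap.ext fun x => Subsingleton.elim _ _)
    obtain ⟨x, hx⟩ := @exists_ne _ (nontrivial_of_indecomposable (h.indecomposable_Q i)) 0
    exact hx (LinearMap.congr_fun h1 x)
  refine indecomposable_of_isIdempotentElem fun e he => ?_
  obtain ⟨ψ, rfl⟩ := exists_homMap_eq hev e
  have hψ : ψ ∘ₗ ψ = ψ := eq_of_homMap_eq hev.2 (by rw [homMap_comp]; exact he)
  rcases eq_zero_or_eq_one_of_isIdempotentElem (h.indecomposable_Q i)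
    (e := ψ) hψ with rfl | rfl
  · exact Or.inl rfl
  · exact Or.inr rfl

lemma eq_of_iso_homFunctor_obj (h : IsExtProjectiveStratifyingSystem Θ Q) {i j : ι}
    (e : (homFunctor (finSum Q)).obj (Q i) ≅ (homFunctor (finSum Q)).obj (Q j)) : i = j := by
  have hi := h.evalMap_bijective (h.filtered_Q i)
  have hj := h.evalMap_bijective (h.filtered_Q j)
  obtain ⟨f, hf⟩ := exists_homMap_eq hi e.hom.hom
  obtain ⟨g, hg⟩ := exists_homMap_eq hj e.inv.hom
  refine h.eq_of_equiv_Q (LinearEquiv.ofLinearMap f g ?_ ?_)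
  · refine eq_of_homMap_eq hj.2 ?_
    rw [homMap_comp, hf, hg, ← ModuleCat.hom_comp, e.inv_hom_id]
    rfl
  · refine eq_of_homMap_eq hi.2 ?_
    rw [homMap_comp, hf, hg, ← ModuleCat.hom_comp, e.hom_inv_id]
    rfl

lemma isRepresentativeSet (h : IsExtProjectiveStratifyingSystem Θ Q)
    [IsArtinianRing (EndOp (finSum Q))] :
    IsRepresentativeSet fun i => (homFunctor (finSum Q)).obj (Q i) where
  finite := finite_homFunctor_obj
  projective := projective_homFunctor_obj
  indecomposable := h.indecomposable_homFunctor_obj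
  injective := fun i j ⟨e⟩ => h.eq_of_iso_homFunctor_obj e
  exhaustive := fun X _ _ hX => by
    obtain ⟨i, ⟨e⟩⟩ := exists_equiv_of_id_mem_through h.indecomposable_homFunctor_obj hX
      (id_mem_through_of_projective X)
    exact ⟨i, ⟨e.toModuleIso⟩⟩

lemma isStandardlyStratified (h : IsExtProjectiveStratifyingSystem Θ Q)
    [IsArtinianRing (EndOp (finSum Q))] :
    IsStandardlyStratified fun i => (homFunctor (finSum Q)).obj (Q i) where
  representative := h.isRepresentativeSet
  filtered := fun X _ _ => .of_id_mem_through h.indecomposable_homFunctor_obj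
    (fun i => h.filtered_homFunctor_obj (h.filtered_Q i)) X (id_mem_through_of_projective X)

lemma isBasic (h : IsExtProjectiveStratifyingSystem Θ Q) : IsBasic (EndOp (finSum Q)) := by
  obtain ⟨n, ⟨e⟩⟩ := Finite.exists_equiv_fin ι
  refine ⟨n, fun k => (homFunctor (finSum Q)).obj (Q (e.symm k)),
    ⟨(regularEquiv (finSum Q)).trans ((homPiEquiv Q (finSum Q)).trans
      (LinearEquiv.piCongrLeft' _ _ e))⟩,
    fun k => h.indecomposable_homFunctor_obj _, fun k l ⟨i⟩ => ?_⟩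
  exact e.symm.injective (h.eq_of_iso_homFunctor_obj i)

end IsExtProjectiveStratifyingSystem

/-! ### Generators of, and additive functions on, the Grothendieck group. -/

section GrothendieckGroup

variable {A : Type u} [Ring A]

/-- The class of a finitely generated module in the Grothendieck group. -/
def K0.mk (X : FGMod A) : K0 A := QuotientAddGroup.mk (FreeAbelianGroup.of X)

lemma K0.mk_eq_add {X Y Z : FGMod A} (f : X.1 →ₗ[A] Y.1) (g : Y.1 →ₗ[A] Z.1)
    (hf : Function.Injective f) (hfg : Function.Exact f g) (hg : Function.Surjective g) :
    K0.mk Y = K0.mk X + K0.mk Z := by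
  have h : FreeAbelianGroup.of Y - FreeAbelianGroup.of X - FreeAbelianGroup.of Z ∈
      AddSubgroup.closure (K0Relations A) :=
    AddSubgroup.subset_closure ⟨X, Y, Z, f, g, hf, hfg, hg, rfl⟩
  rw [← QuotientAddGroup.eq_zero_iff] at h
  have h' : K0.mk Y - K0.mk X - K0.mk Z = 0 := h
  rw [sub_sub, sub_eq_zero] at h'
  exact h'

/-- For `X = 0` the sequence `X → X → X` of identities is short exact, so `[X] = [X] + [X]`. -/
lemma K0.mk_of_subsingleton (X : FGMod A) [Subsingleton X.1] : K0.mk X = 0 := by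
  have h := K0.mk_eq_add (X := X) (Y := X) (Z := X) LinearMap.id LinearMap.id
    Function.injective_id (fun x => by simp [Subsingleton.elim x 0]) Function.surjective_id
  simpa using h

lemma K0.span_range_mk : Submodule.span ℤ (Set.range (K0.mk : FGMod A → K0 A)) = ⊤ := by
  refine Submodule.eq_top_iff'.2 fun x => ?_
  obtain ⟨x, rfl⟩ := QuotientAddGroup.mk_surjective x
  induction x using FreeAbelianGroup.induction_on with
  | zero => exact zero_mem _
  | of X => exact Submodule.subset_span ⟨X, rfl⟩
  | neg X h => exact neg_mem h
  | add x y hx hy => exact add_mem hx hy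

/-- An additive function on finitely generated modules factors over the Grothendieck group. -/
lemma K0.exists_addMonoidHom (d : FGMod A → ℤ)
    (hd : ∀ (X Y Z : FGMod A) (f : X.1 →ₗ[A] Y.1) (g : Y.1 →ₗ[A] Z.1), Function.Injective f →
      Function.Exact f g → Function.Surjective g → d Y = d X + d Z) :
    ∃ l : K0 A →+ ℤ, ∀ X, l (K0.mk X) = d X := by
  refine ⟨QuotientAddGroup.lift _ (FreeAbelianGroup.lift d) ?_, fun X => ?_⟩
  · refine (AddSubgroup.closure_le _).2 ?_
    rintro _ ⟨X, Y, Z, f, g, hf, hfg, hg, rfl⟩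
    change FreeAbelianGroup.lift d _ = 0
    rw [map_sub, map_sub, FreeAbelianGroup.lift_apply_of, FreeAbelianGroup.lift_apply_of,
      FreeAbelianGroup.lift_apply_of, hd X Y Z f g hf hfg hg]
    abel
  · exact FreeAbelianGroup.lift_apply_of d X

/-- Over an artinian ring, the Grothendieck group is generated by the classes of the simple
modules. -/
lemma K0.span_simple [IsArtinianRing A] {ι : Type} (S : ι → FGMod A)
    (hS : ∀ X : ModuleCat.{u} A, IsSimpleModule A X → ∃ i, Nonempty (X ≃ₗ[A] (S i).1)) :
    Submodule.span ℤ (Set.range fun i => K0.mk (S i)) = ⊤ := by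
  rw [eq_top_iff, ← K0.span_range_mk, Submodule.span_le]
  rintro _ ⟨⟨X, hX⟩, rfl⟩
  obtain ⟨n, hn⟩ : ∃ n : ℕ, Module.length A X = n :=
    ⟨_, (ENat.natCast_toNat Module.length_ne_top).symm⟩
  induction n using Nat.strong_induction_on generalizing X with
  | _ n ih =>
    rcases subsingleton_or_nontrivial X with hs | hs
    · rw [K0.mk_of_subsingleton ⟨X, hX⟩]
      exact zero_mem _
    obtain ⟨N, hN⟩ := IsCoatomic.exists_coatom (Submodule A X)
    have hsimple : IsSimpleModule A (X ⧸ N) := isSimpleModule_iff_isCoatom.2 hN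
    obtain ⟨i, ⟨e⟩⟩ := hS (ModuleCat.of A (X ⧸ N)) hsimple
    have hl : Module.length A N < Module.length A X := Submodule.length_lt hN.1
    obtain ⟨m, hm⟩ : ∃ m : ℕ, Module.length A N = m :=
      ⟨_, (ENat.natCast_toNat Module.length_ne_top).symm⟩
    rw [hm, hn] at hl
    have hNf : Module.Finite A (ModuleCat.of A N) := inferInstanceAs (Module.Finite A N)
    have h1 := ih m (by exact_mod_cast hl) (ModuleCat.of A N) hNf hm
    rw [K0.mk_eq_add (X := ⟨ModuleCat.of A N, hNf⟩) (Y := ⟨X, hX⟩) (Z := S i) N.subtype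
      (e.toLinearMap ∘ₗ N.mkQ) N.injective_subtype ?_ (e.surjective.comp N.mkQ_surjective)]
    · exact add_mem h1 (Submodule.subset_span ⟨i, rfl⟩)
    · intro x
      change e (N.mkQ x) = 0 ↔ _
      rw [LinearEquiv.map_eq_zero_iff]
      simp

/-- A projective module with local endomorphism ring has at most one maximal submodule. -/
lemma isCoatom_unique_of_isLocalRing {P : Type u} [AddCommGroup P] [Module A P]
    [Module.Projective A P] [IsLocalRing (Module.End A P)] {N N' : Submodule A P}
    (hN : IsCoatom N) (hN' : IsCoatom N') : N = N' := by
  by_contra hne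
  have hnle : ¬ N ≤ N' := fun hle => hne ((hN.le_iff.1 hle).resolve_left hN'.1).symm
  have hsup : N ⊔ N' = ⊤ := hN'.2 _ (right_lt_sup.2 hnle)
  have hsurj : Function.Surjective (N'.mkQ ∘ₗ N.subtype) := by
    intro y
    obtain ⟨x, rfl⟩ := N'.mkQ_surjective y
    obtain ⟨a, ha, b, hb, rfl⟩ := Submodule.mem_sup.1 (hsup ▸ Submodule.mem_top : x ∈ N ⊔ N')
    refine ⟨⟨a, ha⟩, ?_⟩
    have : N'.mkQ b = 0 := by simpa using hb
    rw [map_add, this, add_zero]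
    rfl
  -- Lifting `P → P / N'` through `N` gives an endomorphism `f` with image in `N` and `1 - f` with
  -- image in `N'`. Neither is a unit, against locality.
  obtain ⟨v, hv⟩ := Module.projective_lifting_property _ N'.mkQ hsurj
  have key : ∀ (L : Submodule A P) (f : Module.End A P), L ≠ ⊤ → (∀ x, f x ∈ L) → ¬ IsUnit f := by
    intro L f hL hf hu
    refine hL (Submodule.eq_top_iff'.2 fun x => ?_)
    obtain ⟨y, rfl⟩ := ((Module.End.isUnit_iff f).1 hu).2 x
    exact hf y
  let f : Module.End A P := N.subtype ∘ₗ v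
  rcases IsLocalRing.isUnit_or_isUnit_of_add_one (add_sub_cancel f 1) with h | h
  · exact key N _ hN.1 (fun x => (v x).2) h
  · refine key N' _ hN'.1 (fun x => ?_) h
    have h1 : N'.mkQ (v x : P) = N'.mkQ x := LinearMap.congr_fun hv x
    rw [← Submodule.ker_mkQ N', LinearMap.mem_ker]
    change N'.mkQ (x - (v x : P)) = 0
    rw [map_sub, h1, sub_self]

/-- If the regular module is a direct summand of a sum of indecomposable projectives `P i`, every
simple module is one of the tops of the `P i`. -/
lemma exists_simple_family [IsArtinianRing A] {ι : Type} (P : ι → ModuleCat.{u} A)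
    (hfin : ∀ i, Module.Finite A (P i)) (hproj : ∀ i, Module.Projective A (P i))
    (hind : ∀ i, Indecomposable (P i))
    (hA : LinearMap.id ∈ through P (ModuleCat.of A A) (ModuleCat.of A A)) :
    ∃ S : ι → FGMod A, ∀ X : ModuleCat.{u} A, IsSimpleModule A X →
      ∃ i, Nonempty (X ≃ₗ[A] (S i).1) := by
  have hN : ∀ i, ∃ N : Submodule A (P i), IsCoatom N := fun i => by
    have := nontrivial_of_indecomposable (hind i)
    exact IsCoatomic.exists_coatom _
  choose N hN using hN
  refine ⟨fun i => ⟨ModuleCat.of A (P i ⧸ N i), inferInstanceAs (Module.Finite A (P i ⧸ N i))⟩,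
    fun X hX => ?_⟩
  -- If all maps `P i → X` were zero, so would be all maps `A → X`, including `1 ↦ x`.
  obtain ⟨i, f, hf⟩ : ∃ (i : ι) (f : P i →ₗ[A] X), f ≠ 0 := by
    by_contra! hcon
    have := IsSimpleModule.nontrivial A X
    obtain ⟨x, hx⟩ := exists_ne (0 : X)
    have key : ∀ a ∈ through P (ModuleCat.of A A) X, a = 0 := by
      intro a ha
      refine AddSubgroup.closure_induction ?_ rfl ?_ ?_ ha
      · rintro _ ⟨i, f, g, rfl⟩
        rw [hcon i g, LinearMap.zero_comp]
      · rintro a b _ _ rfl rfl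
        exact add_zero 0
      · rintro a _ rfl
        exact neg_zero
    have h1 := key (LinearMap.toSpanSingleton A X x)
      (by simpa using comp_mem_through_left hA (LinearMap.toSpanSingleton A X x))
    exact hx (by simpa using LinearMap.congr_fun h1 (1 : A))
  have hs : Function.Surjective f := LinearMap.surjective_of_ne_zero hf
  have hk : IsCoatom (LinearMap.ker f) := by
    rw [← isSimpleModule_iff_isCoatom]
    exact IsSimpleModule.congr (f.quotKerEquivOfSurjective hs)
  have := isLocalRing_end_of_indecomposable (hind i)
  exact ⟨i, ⟨(f.quotKerEquivOfSurjective hs).symm.trans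
    (Submodule.quotEquivOfEq _ _ (isCoatom_unique_of_isLocalRing hk (hN i)))⟩⟩

/-- For an idempotent `e` of an artin algebra, the length of `eX` is an additive function. -/
lemma K0.exists_functional (R : Type w) [CommRing R] [IsArtinianRing R] [Algebra R A]
    [Module.Finite R A] {e : A} (he : IsIdempotentElem e) :
    ∃ l : K0 A →+ ℤ, ∀ X : FGMod A, l (K0.mk X) = 0 ↔ ∀ x : X.1, e • x = 0 := by
  let r (X : FGMod A) : Module R X.1 := Module.restrictScalars R A X.1
  have ht (X : FGMod A) : IsScalarTower R A X.1 := IsScalarTower.restrictScalars R A X.1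
  -- This is `eX`, described as the fixed points of `e`. It is only an `R`-submodule, which is why
  -- lengths are taken over `R`.
  let N (X : FGMod A) : Submodule R X.1 :=
    { carrier := {x | e • x = x}
      add_mem' := fun {x y} hx hy => by
        rw [Set.mem_ofPred_eq] at *
        rw [smul_add, hx, hy]
      zero_mem' := smul_zero e
      smul_mem' := fun c x hx => by
        rw [Set.mem_ofPred_eq] at *
        rw [smul_comm, hx] }
  have hmem : ∀ (X : FGMod A) (x : X.1), x ∈ N X ↔ e • x = x := fun _ _ => Iff.rfl
  have hN (X : FGMod A) : Module.length R (N X) ≠ ⊤ := by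
    have := X.2
    have : Module.Finite R X.1 := Module.Finite.trans A X.1
    exact Module.length_ne_top
  obtain ⟨l, hl⟩ := K0.exists_addMonoidHom (fun X : FGMod A => ((Module.length R (N X)).toNat : ℤ))
    (by
      intro X Y Z f g hf hfg hg
      have hf' : ∀ x ∈ N X, f.restrictScalars R x ∈ N Y := fun x hx => by
        rw [hmem] at *
        change e • f x = f x
        rw [← map_smul, hx]
      have hg' : ∀ y ∈ N Y, g.restrictScalars R y ∈ N Z := fun x hx => by
        rw [hmem] at *
        change e • g x = g x
        rw [← map_smul, hx]
      have key := Module.length_eq_add_of_exact ((f.restrictScalars R).restrict hf')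
        ((g.restrictScalars R).restrict hg')
        (fun x y hxy => Subtype.ext (hf (congrArg Subtype.val hxy))) ?_ ?_
      · rw [key, ENat.toNat_add (hN X) (hN Z)]
        push_cast
        rfl
      · rintro ⟨z, hz⟩
        obtain ⟨y, rfl⟩ := hg z
        -- Multiplying a preimage by `e` moves it into `eY` without changing its image, so `X ↦ eX`
        -- preserves surjections.
        refine ⟨⟨e • y, ?_⟩, Subtype.ext ?_⟩
        · rw [hmem, smul_smul, he.eq]
        · change g (e • y) = g y
          rw [map_smul]
          exact hz
      · rintro ⟨y, hy⟩
        constructor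
        · intro h
          obtain ⟨x, rfl⟩ := (hfg y).1 (congrArg Subtype.val h)
          refine ⟨⟨x, hf ?_⟩, rfl⟩
          rw [map_smul]
          exact hy
        · rintro ⟨x, hx⟩
          have h2 : f x.1 = y := congrArg Subtype.val hx
          refine Subtype.ext ?_
          change g y = 0
          rw [← h2, hfg.apply_apply_eq_zero])
  refine ⟨l, fun X => ?_⟩
  rw [hl, Nat.cast_eq_zero, ENat.toNat_eq_zero, or_iff_left (hN X), Module.length_eq_zero_iff]
  constructor
  · intro hs x
    have h1 : e • x ∈ N X := by rw [hmem, smul_smul, he.eq]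
    exact congrArg Subtype.val (Subsingleton.elim (⟨_, h1⟩ : N X) 0)
  · intro hs
    refine ⟨fun x y => Subtype.ext ?_⟩
    rw [← (hmem X _).1 x.2, ← (hmem X _).1 y.2, hs, hs]

end GrothendieckGroup

/-- In a relation, take the largest index `i` with nonzero coefficient: `l i` kills the smaller
terms, the larger ones are absent, and the coefficient at `i` must vanish. -/
lemma linearIndependent_of_triangular {V : Type*} [AddCommGroup V] {ι : Type*} [Fintype ι]
    [LinearOrder ι] (v : ι → V) (l : ι → V →+ ℤ) (h0 : ∀ i j, j < i → l i (v j) = 0)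
    (h1 : ∀ i, l i (v i) ≠ 0) : LinearIndependent ℤ v := by
  rw [Fintype.linearIndependent_iff]
  intro c hc
  by_contra! hne
  obtain ⟨i, hi, hmax⟩ := (Set.toFinite {i | c i ≠ 0}).exists_maximal hne
  have h2 := congrArg (l i) hc
  rw [map_sum, map_zero, Finset.sum_eq_single i] at h2
  · rw [map_zsmul, smul_eq_mul, mul_eq_zero] at h2
    exact h2.elim hi (h1 i)
  · intro j _ hj
    rcases lt_or_gt_of_ne hj with hj | hj
    · rw [map_zsmul, h0 i j hj, smul_zero]
    · have : c j = 0 := by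
        by_contra hcj
        exact absurd (hmax hcj hj.le) (not_le.2 hj)
      rw [this, zero_smul, map_zero]
  · simp

/-! ### The rank of the Grothendieck group. -/

namespace IsExtProjectiveStratifyingSystem

variable {A : Type u} [Ring A] {ι : Type} [Fintype ι] [LinearOrder ι] {Θ Q : ι → ModuleCat.{u} A}

lemma rank_K0 (h : IsExtProjectiveStratifyingSystem Θ Q)
    (R : Type w) [CommRing R] [IsArtinianRing R] [Algebra R A] [Module.Finite R A] :
    Module.rank ℤ (K0 (EndOp (finSum Q))) = Fintype.card ι := by
  have := h.finite_finSum
  have := isArtinianRing_endOp R (finSum Q)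
  have := h.finite_theta
  apply le_antisymm
  · obtain ⟨S, hS⟩ := exists_simple_family _ finite_homFunctor_obj projective_homFunctor_obj
      h.indecomposable_homFunctor_obj
      (id_mem_through_of_projective (Q := Q) (ModuleCat.of _ (EndOp (finSum Q))))
    rw [← rank_top, ← K0.span_simple S hS]
    refine (rank_span_le _).trans ?_
    have := Cardinal.mk_range_le_lift (f := fun i => K0.mk (S i))
    simpa using this
  · let algebra := endOpAlgebra (finSum Q) R
    have := finite_endOp R (finSum Q)
    choose s r hrs using exists_retract_finSum (Q := Q)
    -- The projection onto `Q i`. Then `e i • F(X)` is a copy of `Hom(Q i, X)`, which for `X = Θ j`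
    -- is zero if `j < i` and nonzero if `j = i`.
    let e (i : ι) : EndOp (finSum Q) := MulOpposite.op (s i ∘ₗ r i)
    have he (i : ι) : IsIdempotentElem (e i) := by
      refine MulOpposite.unop_injective (LinearMap.ext fun x => ?_)
      exact congrArg (s i) (LinearMap.congr_fun (hrs i) (r i x))
    choose l hl using fun i => K0.exists_functional R (he i)
    let v (j : ι) : K0 (EndOp (finSum Q)) :=
      K0.mk ⟨(homFunctor (finSum Q)).obj (Θ j), finite_homFunctor_obj_of_finite R _ _⟩
    have hli : LinearIndependent ℤ v := by
      refine linearIndependent_of_triangular v l (fun i j hij => ?_) (fun i => ?_)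
      · rw [hl]
        intro (k : finSum Q →ₗ[A] Θ j)
        change (k ∘ₗ s i) ∘ₗ r i = 0
        rw [h.hom_Q_theta_eq_zero hij (k ∘ₗ s i), LinearMap.zero_comp]
      · rw [ne_eq, hl]
        intro hz
        obtain ⟨K, α, β, hα, hαβ, hβ, hK⟩ := h.exists_sequence i
        have h1 : (β ∘ₗ r i) ∘ₗ (s i ∘ₗ r i) = 0 := hz (β ∘ₗ r i : finSum Q →ₗ[A] Θ i)
        have := h.nontrivial_theta i
        obtain ⟨x, hx⟩ := exists_ne (0 : Θ i)
        obtain ⟨q, rfl⟩ := hβ x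
        have hq : ∀ q, r i (s i q) = q := LinearMap.congr_fun (hrs i)
        have h2 : β (r i (s i (r i (s i q)))) = 0 := LinearMap.congr_fun h1 (s i q)
        rw [hq, hq] at h2
        exact hx h2
    simpa using hli.cardinal_lift_le_rank

end IsExtProjectiveStratifyingSystem

end StratSys

end

theorem mainTheorem4 {R : Type w} [CommRing R] [IsArtinianRing R]
    {Λ : Type u} [Ring Λ] [Algebra R Λ] [Module.Finite R Λ]
    {ι : Type} [Fintype ι] [LinearOrder ι] (Θ Q : ι → ModuleCat.{u} Λ)
    (hΘ : IsExtProjectiveStratifyingSystem Θ Q) :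
    let T : ModuleCat.{u} Λ := finSum Q
    let F : ModuleCat.{u} Λ ⥤ ModuleCat.{u} (EndOp T) := homFunctor T
    let G : ModuleCat.{u} (EndOp T) ⥤ ModuleCat.{u} Λ := tensorFunctor T
    let P : ι → ModuleCat.{u} (EndOp T) := fun i => F.obj (Q i)
    let Δ : ι → ModuleCat.{u} (EndOp T) := standardModule P
    -- `Γ = End(⨁ Q(i))ᵒᵖ` is an artin `R`-algebra, `F` and `G` preserve finite generation
    (@Module.Finite R (EndOp T) _ _ (endOpAlgebra T R).toModule ∧
      (∀ X : ModuleCat.{u} Λ, Module.Finite Λ X → Module.Finite (EndOp T) (F.obj X)) ∧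
      (∀ Y : ModuleCat.{u} (EndOp T), Module.Finite (EndOp T) Y →
        Module.Finite Λ (G.obj Y))) ∧
    -- (a)
    (IsRepresentativeSet P ∧ IsBasic (EndOp T) ∧
      Module.rank ℤ (K0 (EndOp T)) = Fintype.card ι) ∧
    -- (b)
    IsStandardlyStratified P ∧
    -- (c)
    ((∀ S : ShortComplex (ModuleCat.{u} Λ), Filtered Θ S.X₁ → Filtered Θ S.X₂ →
        Filtered Θ S.X₃ → S.ShortExact → (S.map F).ShortExact) ∧
      ∃ (hF : ∀ X : (Filtered Θ).FullSubcategory, Filtered Δ (F.obj X.obj))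
        (hG : ∀ Y : (Filtered Δ).FullSubcategory, Filtered Θ (G.obj Y.obj))
        (e : (Filtered Θ).FullSubcategory ≌ (Filtered Δ).FullSubcategory),
        e.functor = (Filtered Δ).lift ((Filtered Θ).ι ⋙ F) hF ∧
        e.inverse = (Filtered Θ).lift ((Filtered Δ).ι ⋙ G) hG) ∧
    -- (d)
    (∀ i, Nonempty (F.obj (Θ i) ≅ Δ i)) ∧
    -- (e)
    AddClosure T = Filtered Θ ⊓ LeftPerpOne (Filtered Θ) := by
  intro T F G P Δ
  have hT : Module.Finite Λ T := hΘ.finite_finSum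
  have := isArtinianRing_of_finite_algebra R (Λ := Λ)
  have : IsArtinianRing (EndOp (finSum Q)) := isArtinianRing_endOp R T
  refine ⟨⟨finite_endOp R T, fun X _ => finite_homFunctor_obj_of_finite R T X,
    fun Y _ => finite_tensorFunctor_obj T Y⟩, ⟨hΘ.isRepresentativeSet, hΘ.isBasic, hΘ.rank_K0 R⟩,
    hΘ.isStandardlyStratified, ⟨fun S h₁ _ _ hS => hΘ.homMap_shortExact S h₁ hS,
    hΘ.exists_equivalence⟩, fun i => ?_, hΘ.addClosure_eq⟩
  obtain ⟨e⟩ := hΘ.nonempty_equiv_standardModule i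
  exact ⟨e.toModuleIso⟩
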